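/- Let $d\in\{1,2,\dots\}$, let $\mathcal A\subseteq\mathbb R$ with its Borel $\sigma$-algebra inherited from $\mathbb R$, and let $\Omega:=\mathcal A^{\mathbb Z^d}$ carry the product $\sigma$-algebra $\mathcal B(\Omega)$. Let $\mathcal F$ be the set of finite subsets of $\mathbb Z^d$. For $z\in\mathbb Z^d$ let $(\tau_z\omega)_x:=\omega_{x+z}$, and for $\Lambda\in\mathcal F$ let $\omega_\Lambda:=(\omega_x)_{x\in\Lambda}\in\mathcal A^\Lambda$ and let $\mathbb P_\Lambda$ be the law of $\omega\mapsto\omega_\Lambda$ under $\mathbb P$. Let $\mathbb P$ be a probability measure on $(\Omega,\mathcal B(\Omega))$ and $r\in\mathbb N_0$ such that: * (M1) $\mathbb P\circ\tau_z^{-1}=\mathbb P$ for every $z\in\mathbb Z^d$; * (M2) there are $\sigma$-finite measures $\mu_z$, $z\in\mathbb Z^d$, on $\mathcal A$ such that for every $\Lambda\in\mathcal F$ the marginal $\mathbb P_\Lambda$ is absolutely continuous with respect to $\mu_\Lambda:=\bigotimes_{z\in\Lambda}\mu_z$, with density $\rho_\Lambda:=d\mathbb P_\Lambda/d\mu_\Lambda$;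 * (M3) for all $n$ and all non-empty $\Lambda_1,\dots,\Lambda_n\in\mathcal F$ such that $\|x-y\|_1>r$ whenever $x\in\Lambda_i$, $y\in\Lambda_j$, $i\ne j$, one has, with $\Lambda:=\bigcup_j\Lambda_j$, $\rho_\Lambda(\omega)=\prod_{j=1}^n\rho_{\Lambda_j}(\omega_{\Lambda_j})$ for $\mu_\Lambda$-almost every $\omega\in\mathcal A^\Lambda$. Let $\mathbb B$ be the Banach space of right-continuous bounded functions $\mathbb R\to\mathbb R$ with the supremum norm $\|\cdot\|$. Let $f\colon\mathcal F\times\Omega\to\mathbb B$ be admissible, that is: 1. $f(\Lambda+z,\omega)=f(\Lambda,\tau_z\omega)$ for all $\Lambda\in\mathcal F$, $z\in\mathbb Z^d$, $\omega\in\Omega$; 2. $f(\Lambda,\omega)=f(\Lambda,\omega')$ whenever $\omega_\Lambda=\omega'_\Lambda$; 3. there is $b\colon\mathcal F\to[0,\infty)$ with $\bigl\|f(\bigcup_{i=1}^n\Lambda_i,\omega)-\sum_{i=1}^nf(\Lambda_i,\omega)\bigr\|\le\sum_{i=1}^nb(\Lambda_i)$ for all $\omega\in\Omega$, all $n\ge1$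 and all pairwise disjoint $\Lambda_1,\dots,\Lambda_n\in\mathcal F$, such that $b(\Lambda+z)=b(\Lambda)$ for all $\Lambda\in\mathcal F$ and $z\in\mathbb Z^d$, such that there is $D>0$ with $b(\Lambda)\le D|\Lambda|$ for all $\Lambda\in\mathcal F$, and such that $b(C_i)/|C_i|\to0$ for every sequence $(C_i)$ of cubes $C_i=([0,\ell_i)^d\cap\mathbb Z^d)+z_i$, $z_i\in\mathbb Z^d$, with strictly increasing side lengths $\ell_i\in\mathbb N$; 4. there is $s\in\{-1,1\}^{\mathbb Z^d}$ such that for all $\Lambda\in\mathcal F$, $z\in\Lambda$, $E\in\mathbb R$ and $\omega,\omega'\in\Omega$ with $\omega_{\Lambda\setminus\{z\}}=\omega'_{\Lambda\setminus\{z\}}$ and $\omega_z\le\omega'_z$ one has $f(\Lambda,\omega)(E)\le f(\Lambda,\omega')(E)$ if $s(z)=1$, and $f(\Lambda,\omega)(E)\ge f(\Lambda,\omega')(E)$ if $s(z)=-1$; 5. $\sup_{\omega\in\Omega}\|f(\{0\},\omega)\|<\infty$. Put $\Lambda_n:=[0,n)^d\cap\mathbb Z^d$. Then there exist a set $\tilde\Omega\in\mathcal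 B(\Omega)$ with $\mathbb P(\tilde\Omega)=1$ and a function $f^*\in\mathbb B$ such that for every $\omega\in\tilde\Omega$ $$\lim_{n\to\infty}\Bigl\|\frac{f(\Lambda_n,\omega)}{|\Lambda_n|}-f^*\Bigr\|=0.$$ -/

import Mathlib

open MeasureTheory Filter Topology

/-- The lattice `ℤ^d`. -/
abbrev Site (d : ℕ) : Type := Fin d → ℤ

/-- The `ℓ¹`-distance on `ℤ^d`. -/
def latticeDist {d : ℕ} (x y : Site d) : ℕ := ∑ i, (y i - x i).natAbs

/-- The translate `Λ + z`. -/
def translateSet {d : ℕ} (Λ : Finset (Site d)) (z : Site d) : Finset (Site d) :=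
  Λ.image fun x => x + z

/-- The cube `[0,n)^d ∩ ℤ^d`. -/
noncomputable def cube (d n : ℕ) : Finset (Site d) :=
  Fintype.piFinset fun _ : Fin d => Finset.Ico (0 : ℤ) (n : ℤ)

/-- The colourings `Ω = A^{ℤ^d}`. The product σ-algebra of the Borel σ-algebra that `A` inherits
from `ℝ` is the default measurable structure. -/
abbrev Config (d : ℕ) (A : Set ℝ) : Type := Site d → A

/-- The translation `(τ_z ω)_x = ω_{x+z}`. -/
def shift {d : ℕ} {A : Set ℝ} (z : Site d) (ω : Config d A) : Config d A := fun x => ω (x + z)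

/-- The marginal measure `P_Λ` on `A^Λ`: the law of the restriction of `ω` to `Λ`. -/
noncomputable def marginal {d : ℕ} {A : Set ℝ} (P : Measure (Config d A)) (Λ : Finset (Site d)) :
    Measure (Λ → A) :=
  P.map Λ.restrict

/-- The product measure `μ_Λ` on `A^Λ`. -/
noncomputable def refMeasure {d : ℕ} {A : Set ℝ} (μ : Site d → Measure A) (Λ : Finset (Site d)) :
    Measure (Λ → A) :=
  Measure.pi fun z : Λ => μ z

/-- The density `ρ_Λ = dP_Λ / dμ_Λ`. -/
noncomputable def marginalDensity {d : ℕ} {A : Set ℝ} (P : Measure (Config d A))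
    (μ : Site d → Measure A) (Λ : Finset (Site d)) : (Λ → A) → ENNReal :=
  (marginal P Λ).rnDeriv (refMeasure μ Λ)

/-- (M1): the measure is invariant under all translations. -/
def TranslationInvariant {d : ℕ} {A : Set ℝ} (P : Measure (Config d A)) : Prop :=
  ∀ z : Site d, P.map (shift z) = P

/-- (M2) for the reference measures `μ`: all marginals are absolutely continuous with respect to
products of the σ-finite measures `μ z`. -/
def HasMarginalDensities {d : ℕ} {A : Set ℝ} (P : Measure (Config d A))
    (μ : Site d → Measure A) : Prop :=
  (∀ z, SigmaFinite (μ z)) ∧ ∀ Λ : Finset (Site d), marginal P Λ ≪ refMeasure μ Λ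

/-- (M3) for the reference measures `μ`: densities factorise (almost everywhere, as densities are
only defined up to null sets) over finite non-empty sets at mutual distance larger than `r`. -/
def IndependentAtDistance {d : ℕ} {A : Set ℝ} (P : Measure (Config d A))
    (μ : Site d → Measure A) (r : ℕ) : Prop :=
  ∀ (n : ℕ) (L : Fin n → Finset (Site d)), (∀ j, (L j).Nonempty) →
    (∀ i j, i ≠ j → ∀ x ∈ L i, ∀ y ∈ L j, r < latticeDist x y) →
    marginalDensity P μ (Finset.univ.biUnion L) =ᵐ[refMeasure μ (Finset.univ.biUnion L)]
      fun ω => ∏ j, marginalDensity P μ (L j)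
        (Finset.restrict₂ (π := fun _ => A) (Finset.subset_biUnion_of_mem L (Finset.mem_univ j)) ω)

/-- (M1), (M2) and (M3) with correlation length `r`. -/
structure SatisfiesM123 {d : ℕ} {A : Set ℝ} (P : Measure (Config d A)) (r : ℕ) : Prop where
  translationInvariant : TranslationInvariant P
  densities : ∃ μ : Site d → Measure A, HasMarginalDensities P μ ∧ IndependentAtDistance P μ r

/-- The right-continuous bounded functions `ℝ → ℝ`, as a subspace of the Banach space of all
bounded functions `ℝ → ℝ` with the supremum norm. -/
def rightContBdd : Submodule ℝ (lp (fun _ : ℝ => ℝ) ⊤) where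
  carrier := {F | ∀ x : ℝ, ContinuousWithinAt (fun y : ℝ => F y) (Set.Ici x) x}
  add_mem' := fun hF hG x => (hF x).add (hG x)
  zero_mem' := fun _ => continuousWithinAt_const
  smul_mem' := fun c _ hF x => (hF x).const_smul c

/-- The Banach space `𝔹`. Its norm is the supremum norm; the value of `F : RCB` at `E` is
`F.1 E`. -/
abbrev RCB : Type := rightContBdd

/-- `b` is a boundary term for `f`: it bounds the defect from additivity, is non-negative,
translation invariant, at most linear in the volume, and negligible along cubes with strictly
increasing side lengths. -/
structure IsBoundaryTerm {d : ℕ} {A : Set ℝ} (f : Finset (Site d) → Config d A → RCB)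
    (b : Finset (Site d) → ℝ) : Prop where
  nonneg : ∀ Λ, 0 ≤ b Λ
  almost_additive : ∀ (ω : Config d A) (n : ℕ), 0 < n → ∀ L : Fin n → Finset (Site d),
    (∀ i j, i ≠ j → Disjoint (L i) (L j)) →
    ‖f (Finset.univ.biUnion L) ω - ∑ i, f (L i) ω‖ ≤ ∑ i, b (L i)
  translate : ∀ (Λ : Finset (Site d)) (z : Site d), b (translateSet Λ z) = b Λ
  linear_bound : ∃ D : ℝ, 0 < D ∧ ∀ Λ : Finset (Site d), b Λ ≤ D * (Λ.card : ℝ)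
  cubes : ∀ (ℓ : ℕ → ℕ) (z : ℕ → Site d), StrictMono ℓ →
    Tendsto (fun i => b (translateSet (cube d (ℓ i)) (z i)) /
      ((translateSet (cube d (ℓ i)) (z i)).card : ℝ)) atTop (𝓝 0)

/-- Admissible functions `f : 𝓕 × Ω → 𝔹`. -/
structure IsAdmissible {d : ℕ} {A : Set ℝ} (f : Finset (Site d) → Config d A → RCB) : Prop where
  translation_invariant : ∀ (Λ : Finset (Site d)) (z : Site d) (ω : Config d A),
    f (translateSet Λ z) ω = f Λ (shift z ω)
  is_local : ∀ (Λ : Finset (Site d)) (ω ω' : Config d A),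
    (∀ x ∈ Λ, ω x = ω' x) → f Λ ω = f Λ ω'
  almost_additive : ∃ b : Finset (Site d) → ℝ, IsBoundaryTerm f b
  monotone : ∃ s : Site d → ℤˣ, ∀ (Λ : Finset (Site d)) (ω ω' : Config d A),
    ∀ z ∈ Λ, ∀ E : ℝ, (∀ x ∈ Λ, x ≠ z → ω x = ω' x) → ω z ≤ ω' z →
      (s z = 1 → (f Λ ω).1 E ≤ (f Λ ω').1 E) ∧ (s z = -1 → (f Λ ω').1 E ≤ (f Λ ω).1 E)
  bounded : ∃ C : ℝ, ∀ ω : Config d A, ‖f {0} ω‖ ≤ C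

/-! Almost additivity reduces a huge cube to many translates of a fixed cube of side `q`, separated
by corridors of width `r`. The corridors, the leftover boundary layer and the defect of additivity
cost little per site once `q` is large (`norm_cube_sub_sum_le`). By (M3) the restrictions to the
separated cubes are independent (`iIndepFun_restrict`), and by (M1) they are identically
distributed, so for each `E` a law of large numbers applies.

The point is uniformity in `E`, a Glivenko–Cantelli statement over the functions `f(Λ_q, ·)(E)`.
They are bounded and coordinatewise monotone with common directions, and by (M2) the marginal is
absolutely continuous with respect to a product measure. For a product of probability measures,
quantile grids in each coordinate give one finite coding through which every such function is
bracketed with small mean gap (`exists_finite_coding_pi`); absolute continuity carries this over to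
the marginal (`exists_finite_bracketing`). As the coding does not depend on `E`, convergence of
finitely many code frequencies controls all `E` together.

Large cubes are thus almost surely eventually within any `ε` of a deterministic function of `E`.
Completeness of `RCB` turns these approximations into a limit `f*`. -/

/-! ### Quantile grids and finite codings for monotone functions -/

/-- The `j`-th quantile at mesh `δ` of a measure on the extended reals. -/
noncomputable def meshQuantile (ν : Measure EReal) (δ : ENNReal) (j : ℕ) : EReal :=
  sInf {y | (j : ENNReal) * δ ≤ ν (Set.Iic y)}

lemma meshQuantile_mono (ν : Measure EReal) (δ : ENNReal) : Monotone (meshQuantile ν δ) := by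
  intro i j hij
  refine sInf_le_sInf fun y hy => ?_
  rw [Set.mem_ofPred_eq] at hy ⊢
  exact le_trans (by gcongr) hy

lemma meshQuantile_zero (ν : Measure EReal) (δ : ENNReal) : meshQuantile ν δ 0 = ⊥ := by
  simp [meshQuantile]

lemma meshQuantile_eq_top (ν : Measure EReal) [IsProbabilityMeasure ν] (δ : ENNReal) {j : ℕ}
    (hj : 1 < (j : ENNReal) * δ) : meshQuantile ν δ j = ⊤ := by
  have : {y | (j : ENNReal) * δ ≤ ν (Set.Iic y)} = ∅ := by
    ext y
    simp only [Set.mem_ofPred_eq, Set.mem_empty_iff_false, iff_false, not_le]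
    exact prob_le_one.trans_lt hj
  rw [meshQuantile, this, sInf_empty]

/-- A point above the `j`-th quantile has mass at least `j * δ` weakly below it, and a point below
the next quantile has mass less than `(j + 1) * δ`; subtract and exhaust from inside. The interval
must be open, since the quantiles may be heavy atoms. -/
lemma measure_Ioo_meshQuantile_le (ν : Measure EReal) [IsProbabilityMeasure ν] (δ : ENNReal)
    (j : ℕ) : ν (Set.Ioo (meshQuantile ν δ j) (meshQuantile ν δ (j + 1))) ≤ δ := by
  set a := meshQuantile ν δ j with ha
  set b := meshQuantile ν δ (j + 1) with hb
  rcases le_or_gt b a with hab | hab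
  · simp [Set.Ioo_eq_empty_of_le hab]
  obtain ⟨u, hu, hu', hut⟩ := exists_seq_strictAnti_tendsto' hab
  obtain ⟨v, hv, hv', hvt⟩ := exists_seq_strictMono_tendsto' hab
  have hU : Set.Ioo a b = ⋃ n, Set.Ioc (u n) (v n) := by
    ext x
    simp only [Set.mem_Ioo, Set.mem_iUnion, Set.mem_Ioc]
    constructor
    · rintro ⟨h1, h2⟩
      obtain ⟨n, hn1, hn2⟩ :=
        ((hut.eventually (gt_mem_nhds h1)).and (hvt.eventually (lt_mem_nhds h2))).exists
      exact ⟨n, hn1, hn2.le⟩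
    · rintro ⟨n, h1, h2⟩
      exact ⟨(hu' n).1.trans h1, h2.trans_lt (hv' n).2⟩
  have hmono : Monotone fun n => Set.Ioc (u n) (v n) := fun m n hmn =>
    Set.Ioc_subset_Ioc (hu.antitone hmn) (hv.monotone hmn)
  rw [hU]
  refine le_of_tendsto' (tendsto_measure_iUnion_atTop hmono) fun n => ?_
  have h1 : (j : ENNReal) * δ ≤ ν (Set.Iic (u n)) := by
    obtain ⟨y, hy, hyu⟩ := sInf_lt_iff.1 (hu' n).1
    exact le_trans hy (measure_mono (Set.Iic_subset_Iic.2 hyu.le))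
  have h2 : ν (Set.Iic (v n)) < ((j + 1 : ℕ) : ENNReal) * δ := by
    by_contra h
    exact absurd (sInf_le (Set.mem_ofPred_eq ▸ not_lt.1 h)) (not_le.2 (hv' n).2)
  rcases le_or_gt (v n) (u n) with hvu | huv
  · simp [Set.Ioc_eq_empty_of_le hvu]
  · have hsum : ν (Set.Iic (u n)) + ν (Set.Ioc (u n) (v n)) = ν (Set.Iic (v n)) := by
      rw [← measure_union _ measurableSet_Ioc, Set.Iic_union_Ioc_eq_Iic huv.le]
      exact Set.disjoint_left.2 fun x hx hx' => absurd hx'.1 (not_lt.2 hx)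
    have hfin : (j : ENNReal) * δ ≠ ⊤ := ne_top_of_le_ne_top (measure_ne_top _ _) h1
    refine (ENNReal.add_le_add_iff_left hfin).1 ?_
    calc (j : ENNReal) * δ + ν (Set.Ioc (u n) (v n)) ≤ ν (Set.Iic (v n)) := by
          rw [← hsum]; gcongr
      _ ≤ ((j + 1 : ℕ) : ENNReal) * δ := h2.le
      _ = (j : ENNReal) * δ + δ := by push_cast; ring

/-- A finite measurable coding of a probability space through an extended real variable, with
lower and upper values for every code, for which monotone functions oscillate little on average. -/
lemma exists_finite_coding {X : Type*} [MeasurableSpace X] (μ : Measure X)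
    [IsProbabilityMeasure μ] {ι : X → EReal} (hι : Measurable ι) {δ : ENNReal} (hδ : δ ≠ 0) :
    ∃ (M : ℕ) (c : X → Fin M × Fin M) (lo hi : Fin M × Fin M → EReal), Measurable c ∧
      (∀ x, lo (c x) ≤ ι x ∧ ι x ≤ hi (c x)) ∧
      ∀ h : EReal → ℝ, Monotone h →
        ∫⁻ x, ENNReal.ofReal (h (hi (c x)) - h (lo (c x))) ∂μ ≤
          δ * ENNReal.ofReal (h ⊤ - h ⊥) := by
  classical
  have : IsProbabilityMeasure (μ.map ι) := Measure.isProbabilityMeasure_map hι.aemeasurable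
  obtain ⟨M, hM⟩ : ∃ M : ℕ, 1 < (M : ENNReal) * δ := by
    rcases eq_or_ne δ ⊤ with rfl | hδt
    · exact ⟨1, by simp⟩
    · obtain ⟨M, hM⟩ := ENNReal.exists_nat_gt (ENNReal.inv_ne_top.2 hδ)
      refine ⟨M, ?_⟩
      rw [mul_comm]
      calc (1 : ENNReal) = δ * δ⁻¹ := (ENNReal.mul_inv_cancel hδ hδt).symm
        _ < δ * M := ENNReal.mul_lt_mul_right hδ hδt hM
  set t := meshQuantile (μ.map ι) δ with ht
  have htm : Monotone t := meshQuantile_mono _ _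
  have ht0 : t 0 = ⊥ := meshQuantile_zero _ _
  have htM : t M = ⊤ := meshQuantile_eq_top _ _ hM
  have hex : ∀ x, ∃ j, ι x ≤ t j := fun x => ⟨M, htM ▸ le_top⟩
  -- A point lying exactly on the grid gets equal lower and upper values, so atoms there cost
  -- nothing; any other point lies in an open gap between neighbouring quantiles.
  set p : X → ℕ := fun x => Nat.findGreatest (fun j => t j ≤ ι x) M with hp
  set q : X → ℕ := fun x => Nat.find (hex x) with hq
  have hpm : Measurable p := measurable_findGreatest fun k _ => measurableSet_le measurable_const hι
  have hqm : Measurable q := measurable_find hex fun k => measurableSet_le hι measurable_const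
  have hpM : ∀ x, p x < M + 1 := fun x => Nat.lt_succ_of_le (Nat.findGreatest_le M)
  have hqM : ∀ x, q x < M + 1 := fun x => Nat.lt_succ_of_le (Nat.find_min' _ (htM ▸ le_top))
  have hpx : ∀ x, t (p x) ≤ ι x := fun x =>
    Nat.findGreatest_spec (P := fun j => t j ≤ ι x) (Nat.zero_le M) (ht0 ▸ bot_le)
  have hqx : ∀ x, ι x ≤ t (q x) := fun x => Nat.find_spec (hex x)
  refine ⟨M + 1, fun x => (⟨p x, hpM x⟩, ⟨q x, hqM x⟩), fun a => t a.1, fun a => t a.2, ?_, ?_, ?_⟩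
  · refine Measurable.prodMk ?_ ?_
    · refine measurable_to_countable' fun k => ?_
      convert hpm (measurableSet_singleton (k : ℕ)) using 1
      ext x; simp [Fin.ext_iff]
    · refine measurable_to_countable' fun k => ?_
      convert hqm (measurableSet_singleton (k : ℕ)) using 1
      ext x; simp [Fin.ext_iff]
  · exact fun x => ⟨hpx x, hqx x⟩
  · intro h hh
    have hpt : ∀ x, ENNReal.ofReal (h (t (q x)) - h (t (p x))) ≤
        ∑ j ∈ Finset.range M, (ι ⁻¹' Set.Ioo (t j) (t (j + 1))).indicator
          (fun _ => ENNReal.ofReal (h (t (j + 1)) - h (t j))) x := by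
      intro x
      rcases eq_or_ne (t (p x)) (t (q x)) with heq | hne
      · simp [heq]
      have hpq : p x < q x := by
        by_contra hcon
        exact hne (le_antisymm ((hpx x).trans (hqx x)) (htm (not_lt.1 hcon)))
      have hqle := hqM x
      have hlt2 : ι x < t (p x + 1) := by
        by_contra hcon
        have := Nat.le_findGreatest (P := fun j => t j ≤ ι x) (n := M) (m := p x + 1)
          (by omega) (not_lt.1 hcon)
        simp only [hp] at this
        omega
      have hq1 : q x = p x + 1 :=
        le_antisymm (Nat.find_min' (hex x) hlt2.le) hpq
      have hlt1 : t (p x) < ι x := lt_of_not_ge fun hcon =>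
        Nat.find_min (hex x) (m := p x) hpq hcon
      have hmem : p x ∈ Finset.range M := Finset.mem_range.2 (by omega)
      refine le_trans (le_of_eq ?_) (Finset.single_le_sum (f := fun j =>
        (ι ⁻¹' Set.Ioo (t j) (t (j + 1))).indicator
          (fun _ => ENNReal.ofReal (h (t (j + 1)) - h (t j))) x) (fun _ _ => zero_le) hmem)
      rw [Set.indicator_of_mem (show x ∈ ι ⁻¹' Set.Ioo (t (p x)) (t (p x + 1)) from
        ⟨hlt1, hlt2⟩), hq1]
    calc ∫⁻ x, ENNReal.ofReal (h (t (q x)) - h (t (p x))) ∂μ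
        ≤ ∫⁻ x, ∑ j ∈ Finset.range M, (ι ⁻¹' Set.Ioo (t j) (t (j + 1))).indicator
          (fun _ => ENNReal.ofReal (h (t (j + 1)) - h (t j))) x ∂μ := lintegral_mono hpt
      _ = ∑ j ∈ Finset.range M, ENNReal.ofReal (h (t (j + 1)) - h (t j)) *
            (μ.map ι) (Set.Ioo (t j) (t (j + 1))) := by
          rw [lintegral_finsetSum _ fun j _ =>
            measurable_const.indicator (hι measurableSet_Ioo)]
          refine Finset.sum_congr rfl fun j _ => ?_
          rw [lintegral_indicator_const (hι measurableSet_Ioo),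
            Measure.map_apply hι measurableSet_Ioo]
      _ ≤ ∑ j ∈ Finset.range M, ENNReal.ofReal (h (t (j + 1)) - h (t j)) * δ := by
          gcongr with j
          exact measure_Ioo_meshQuantile_le _ _ j
      _ = δ * ENNReal.ofReal (h ⊤ - h ⊥) := by
          rw [← Finset.sum_mul, ← ENNReal.ofReal_sum_of_nonneg
            (fun j _ => sub_nonneg.2 (hh (htm (Nat.le_succ j)))),
            Finset.sum_range_sub (fun j => h (t j)), htM, ht0, mul_comm]

/-- On a finite product of probability spaces there is a finite measurable coding for which all
bounded monotone functions of the coordinates oscillate little on average. -/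
lemma exists_finite_coding_pi {I : Type*} [Fintype I] {X : I → Type*}
    [∀ i, MeasurableSpace (X i)] (μ : ∀ i, Measure (X i)) [∀ i, IsProbabilityMeasure (μ i)]
    {ι : ∀ i, X i → EReal} (hι : ∀ i, Measurable (ι i)) (K : ℝ) {ε : ENNReal} (hε : ε ≠ 0) :
    ∃ (M : I → ℕ) (c : ∀ i, X i → Fin (M i) × Fin (M i))
      (lo hi : ∀ i, Fin (M i) × Fin (M i) → EReal), (∀ i, Measurable (c i)) ∧
      (∀ i x, lo i (c i x) ≤ ι i x ∧ ι i x ≤ hi i (c i x)) ∧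
      ∀ g : (I → EReal) → ℝ, Monotone g → (∀ y, |g y| ≤ K) →
        ∫⁻ x, ENNReal.ofReal (g (fun i => hi i (c i (x i))) - g (fun i => lo i (c i (x i))))
          ∂(Measure.pi μ) ≤ ε := by
  classical
  obtain ⟨δ, hδ, hδε⟩ : ∃ δ : ENNReal, δ ≠ 0 ∧
      (Fintype.card I : ENNReal) * (δ * ENNReal.ofReal (2 * K)) ≤ ε := by
    have hT : (Fintype.card I : ENNReal) * ENNReal.ofReal (2 * K) ≠ ⊤ :=
      ENNReal.mul_ne_top (ENNReal.natCast_ne_top _) ENNReal.ofReal_ne_top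
    refine ⟨ε / ((Fintype.card I : ENNReal) * ENNReal.ofReal (2 * K)),
      (ENNReal.div_pos hε hT).ne', ?_⟩
    calc _ = ε / ((Fintype.card I : ENNReal) * ENNReal.ofReal (2 * K)) *
          ((Fintype.card I : ENNReal) * ENNReal.ofReal (2 * K)) := by ring
      _ ≤ ε := ENNReal.mul_le_of_le_div le_rfl
  choose M c lo hi hc hb hint using fun i => exists_finite_coding (μ i) (hι i) hδ
  refine ⟨M, c, lo, hi, hc, hb, fun g hg hK => ?_⟩
  have hX : Nonempty (∀ i, X i) := by
    refine ⟨fun i => ?_⟩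
    exact (nonempty_of_isProbabilityMeasure (μ i)).some
  obtain ⟨x₀⟩ := hX
  -- Interpolates between all lower values (`S = ∅`) and all upper values (`S = univ`), raising one
  -- coordinate at a time.
  set y : Finset I → (∀ i, X i) → I → EReal := fun S x i =>
    if i ∈ S then hi i (c i (x i)) else lo i (c i (x i)) with hy
  have hcm : Measurable fun (x : ∀ i, X i) i => c i (x i) :=
    measurable_pi_lambda _ fun i => (hc i).comp (measurable_pi_apply i)
  -- No measurability of `g` is needed: it is evaluated at finitely many points only, through the
  -- codes.
  have hmeas : ∀ S : Finset I, Measurable fun x => g (y S x) := by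
    intro S
    have : (fun x => g (y S x)) = (fun a : ∀ i, Fin (M i) × Fin (M i) =>
      g fun i => if i ∈ S then hi i (a i) else lo i (a i)) ∘ fun x i => c i (x i) := rfl
    rw [this]
    exact (Measurable.of_discrete).comp hcm
  have hstep : ∀ (S : Finset I) (i : I), i ∉ S →
      ∫⁻ x, ENNReal.ofReal (g (y (insert i S) x) - g (y S x)) ∂(Measure.pi μ) ≤
        δ * ENNReal.ofReal (2 * K) := by
    intro S i hi'
    have hF : Measurable fun x => ENNReal.ofReal (g (y (insert i S) x) - g (y S x)) :=
      ((hmeas _).sub (hmeas _)).ennreal_ofReal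
    -- With the other coordinates frozen, the increment is the oscillation of a monotone function of
    -- one variable.
    have hpt : ∀ x : ∀ i, X i, ∫⁻ xi, ENNReal.ofReal
        (g (y (insert i S) (Function.update x i xi)) - g (y S (Function.update x i xi))) ∂(μ i) ≤
        δ * ENNReal.ofReal (2 * K) := by
      intro x
      set h : EReal → ℝ := fun e => g (Function.update (y S x) i e) with hh
      have hhm : Monotone h := fun a b hab => hg (update_le_update_iff.2
        ⟨hab, fun _ _ => le_rfl⟩)
      have e1 : ∀ xi, y (insert i S) (Function.update x i xi) =
          Function.update (y S x) i (hi i (c i xi)) := by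
        intro xi; ext k
        by_cases hk : k = i
        · subst hk; simp [hy]
        · simp [hy, hk]
      have e2 : ∀ xi, y S (Function.update x i xi) =
          Function.update (y S x) i (lo i (c i xi)) := by
        intro xi; ext k
        by_cases hk : k = i
        · subst hk; simp [hy, hi']
        · simp [hy, hk]
      simp_rw [e1, e2]
      refine (hint i h hhm).trans ?_
      gcongr
      have := abs_le.1 (hK (Function.update (y S x) i ⊤))
      have := abs_le.1 (hK (Function.update (y S x) i ⊥))
      simp only [hh]
      linarith
    rw [lintegral_eq_lmarginal_univ x₀,
      ← Finset.insert_erase (Finset.mem_univ i), lmarginal_insert' _ hF (Finset.notMem_erase _ _)]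
    refine (lmarginal_mono (g := fun _ => δ * ENNReal.ofReal (2 * K)) hpt x₀).trans ?_
    simp [lmarginal]
  have hall : ∀ S : Finset I, ∫⁻ x, ENNReal.ofReal (g (y S x) - g (y ∅ x)) ∂(Measure.pi μ) ≤
      (S.card : ENNReal) * (δ * ENNReal.ofReal (2 * K)) := by
    intro S
    induction S using Finset.induction_on with
    | empty => simp
    | insert i S hi' ih =>
      calc ∫⁻ x, ENNReal.ofReal (g (y (insert i S) x) - g (y ∅ x)) ∂(Measure.pi μ)
          ≤ ∫⁻ x, (ENNReal.ofReal (g (y (insert i S) x) - g (y S x)) +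
              ENNReal.ofReal (g (y S x) - g (y ∅ x))) ∂(Measure.pi μ) := by
            refine lintegral_mono fun x => ?_
            refine le_trans (le_of_eq ?_) ENNReal.ofReal_add_le
            congr 1; ring
        _ = _ := lintegral_add_left ((hmeas _).sub (hmeas _)).ennreal_ofReal _
        _ ≤ δ * ENNReal.ofReal (2 * K) + (S.card : ENNReal) * (δ * ENNReal.ofReal (2 * K)) :=
            add_le_add (hstep S i hi') ih
        _ = _ := by rw [Finset.card_insert_of_notMem hi']; push_cast; ring
  have := (hall Finset.univ).trans hδε
  simpa [hy] using this

/-! ### Change of measure and finite brackets -/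

/-- The product of the one-coordinate densities is a density of the product measure: on boxes its
integral factorises because coordinates are independent under `Measure.pi π`. -/
lemma pi_absolutelyContinuous_pi {I : Type*} [Fintype I] {X : I → Type*}
    [∀ i, MeasurableSpace (X i)] (μ π : ∀ i, Measure (X i)) [∀ i, SigmaFinite (μ i)]
    [∀ i, IsProbabilityMeasure (π i)] (h : ∀ i, μ i ≪ π i) :
    Measure.pi μ ≪ Measure.pi π := by
  classical
  have key : Measure.pi μ = (Measure.pi π).withDensity
      (fun x => ∏ i, (μ i).rnDeriv (π i) (x i)) := by
    refine Measure.pi_eq fun s hs => ?_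
    rw [withDensity_apply _ (MeasurableSet.univ_pi hs),
      ← lintegral_indicator (MeasurableSet.univ_pi hs)]
    have hpt : ∀ x : ∀ i, X i, (Set.univ.pi s).indicator
        (fun x => ∏ i, (μ i).rnDeriv (π i) (x i)) x =
        ∏ i, (s i).indicator ((μ i).rnDeriv (π i)) (x i) := by
      intro x
      by_cases hx : x ∈ Set.univ.pi s
      · rw [Set.indicator_of_mem hx]
        exact Finset.prod_congr rfl fun i _ => (Set.indicator_of_mem (hx i trivial) _).symm
      · rw [Set.indicator_of_notMem hx]
        simp only [Set.mem_pi, Set.mem_univ, true_implies, not_forall] at hx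
        obtain ⟨i, hi⟩ := hx
        exact (Finset.prod_eq_zero (Finset.mem_univ i) (Set.indicator_of_notMem hi _)).symm
    simp_rw [hpt]
    have hm : ∀ i, Measurable ((s i).indicator ((μ i).rnDeriv (π i))) := fun i =>
      (Measure.measurable_rnDeriv _ _).indicator (hs i)
    have hind := ProbabilityTheory.iIndepFun_pi (μ := π)
      (X := fun i => (s i).indicator ((μ i).rnDeriv (π i))) (fun i => (hm i).aemeasurable)
    have hprod := ProbabilityTheory.lintegral_prod_eq_prod_lintegral_of_indepFun
      (s := Finset.univ) _ hind (fun i => (hm i).comp (measurable_pi_apply i))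
    rw [hprod]
    refine Finset.prod_congr rfl fun i _ => ?_
    rw [(measurePreserving_eval π i).lintegral_comp (hm i), lintegral_indicator (hs i), Measure.setLIntegral_rnDeriv (h i)]
  rw [key]
  exact withDensity_absolutelyContinuous _ _

lemma exists_pos_measure_lt_of_absolutelyContinuous {X : Type*} [MeasurableSpace X]
    {ν π : Measure X} [IsFiniteMeasure ν] [IsFiniteMeasure π] (h : ν ≪ π) {ε : ENNReal}
    (hε : ε ≠ 0) : ∃ δ > 0, ∀ s, π s < δ → ν s < ε := by
  have hne : ∫⁻ x, ν.rnDeriv π x ∂π ≠ ⊤ := (Measure.lintegral_rnDeriv_lt_top ν π).ne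
  obtain ⟨δ, hδ, hs⟩ := exists_pos_setLIntegral_lt_of_measure_lt hne hε
  exact ⟨δ, hδ, fun s hss => by simpa [Measure.setLIntegral_rnDeriv h] using hs s hss⟩

/-- Uniform integrability of bounded functions under a change to an absolutely continuous
measure. -/
lemma exists_pos_lintegral_le_of_absolutelyContinuous {X : Type*} [MeasurableSpace X]
    {ν π : Measure X} [IsProbabilityMeasure ν] [IsFiniteMeasure π] (h : ν ≪ π) {B : ENNReal}
    (hB : B ≠ ⊤) {ε : ENNReal} (hε : ε ≠ 0) (hε' : ε ≠ ⊤) :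
    ∃ δ : ENNReal, δ ≠ 0 ∧ ∀ F : X → ENNReal, Measurable F → (∀ x, F x ≤ B) →
      ∫⁻ x, F x ∂π ≤ δ → ∫⁻ x, F x ∂ν ≤ ε := by
  have hη : ε / 2 ≠ 0 := (ENNReal.half_pos hε).ne'
  have hη' : ε / 2 ≠ ⊤ := ENNReal.div_ne_top hε' two_ne_zero
  have hB1 : B + 1 ≠ ⊤ := ENNReal.add_ne_top.2 ⟨hB, ENNReal.one_ne_top⟩
  obtain ⟨δ, hδ, hs⟩ := exists_pos_measure_lt_of_absolutelyContinuous h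
    (ENNReal.div_pos hη hB1).ne'
  obtain ⟨δ', hδ'0, hδ'⟩ := exists_between hδ
  -- Markov's inequality at level `ε / 2`: the set where `F` exceeds it has `π`-mass at most `δ' <
  -- δ`, hence small `ν`-mass.
  refine ⟨ε / 2 * δ', mul_ne_zero hη hδ'0.ne', fun F hF hFB hint => ?_⟩
  have hπ : π {x | ε / 2 ≤ F x} < δ := by
    refine lt_of_le_of_lt ((meas_ge_le_lintegral_div hF.aemeasurable hη hη').trans ?_) hδ'
    rw [ENNReal.div_le_iff hη hη', mul_comm]
    exact hint
  have hS : MeasurableSet {x | ε / 2 ≤ F x} := measurableSet_le measurable_const hF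
  calc ∫⁻ x, F x ∂ν ≤ ∫⁻ x, (ε / 2 + {x | ε / 2 ≤ F x}.indicator (fun _ => B + 1) x) ∂ν := by
        refine lintegral_mono fun x => ?_
        by_cases hx : ε / 2 ≤ F x
        · rw [Set.indicator_of_mem (Set.mem_ofPred_eq ▸ hx)]
          exact (hFB x).trans (le_self_add.trans le_add_self)
        · rw [Set.indicator_of_notMem (by simpa using hx), add_zero]
          exact (not_le.1 hx).le
    _ = ε / 2 + (B + 1) * ν {x | ε / 2 ≤ F x} := by
        rw [lintegral_add_left measurable_const, lintegral_indicator_const hS]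
        simp
    _ ≤ ε / 2 + (B + 1) * (ε / 2 / (B + 1)) := by
        gcongr
        exact (hs _ hπ).le
    _ ≤ ε / 2 + ε / 2 := by gcongr; exact ENNReal.mul_div_le
    _ = ε := ENNReal.add_halves ε

/-- For a probability measure on `A^I` that is absolutely continuous with respect to a product of
σ-finite measures, the bounded functions that are monotone in every coordinate, with prescribed
directions `s`, have finite brackets which are functions of one finite measurable coding. -/
lemma exists_finite_bracketing {I : Type*} [Fintype I] {A : Set ℝ} (s : I → ℤˣ)
    (μ : I → Measure A) [∀ i, SigmaFinite (μ i)] (ν : Measure (I → A)) [IsProbabilityMeasure ν]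
    (hν : ν ≪ Measure.pi μ) (K : ℝ) {ε : ℝ} (hε : 0 < ε) :
    ∃ (n : ℕ) (c : (I → A) → Fin n), Measurable c ∧ ∀ g : (I → A) → ℝ,
      (∀ x y, (∀ i, ((s i : ℤ) : ℝ) * x i ≤ ((s i : ℤ) : ℝ) * y i) → g x ≤ g y) →
      (∀ x, |g x| ≤ K) → ∃ l u : Fin n → ℝ, (∀ j, |l j| ≤ K) ∧ (∀ j, |u j| ≤ K) ∧
        (∀ x, l (c x) ≤ g x ∧ g x ≤ u (c x)) ∧
        ∑ j, (u j - l j) * ν.real (c ⁻¹' {j}) ≤ ε := by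
  classical
  have hμ0 : ∀ i, NeZero (μ i) := by
    intro i
    refine ⟨fun h0 => ?_⟩
    have h1 : Measure.pi μ Set.univ = 0 := by
      rw [Measure.pi_univ]
      exact Finset.prod_eq_zero (Finset.mem_univ i) (by simp [h0])
    simpa using hν h1
  -- The codings need probability measures; a nonzero σ-finite measure is absolutely continuous with
  -- respect to its `toFinite`.
  set π : I → Measure A := fun i => (μ i).toFinite with hπ
  have hπp : ∀ i, IsProbabilityMeasure (π i) := fun i => by
    have := hμ0 i
    simp only [hπ]; infer_instance
  have hac : ν ≪ Measure.pi π :=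
    hν.trans (pi_absolutelyContinuous_pi μ π fun i => absolutelyContinuous_toFinite _)
  obtain ⟨δ, hδ, hF⟩ := exists_pos_lintegral_le_of_absolutelyContinuous hac
    (B := ENNReal.ofReal (2 * K)) ENNReal.ofReal_ne_top
    (ENNReal.ofReal_pos.2 hε).ne' ENNReal.ofReal_ne_top
  -- Multiplying by the sign makes every direction increasing.
  set ι : ∀ _ : I, A → EReal := fun i x => ((((s i : ℤ) : ℝ) * (x : ℝ) : ℝ) : EReal) with hι
  have hιm : ∀ i, Measurable (ι i) := fun i =>
    measurable_coe_real_ereal.comp (measurable_subtype_coe.const_mul _)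
  obtain ⟨M, c, lo, hi, hc, hb, hint⟩ := exists_finite_coding_pi π hιm K hδ
  let e := Fintype.equivFin (∀ i, Fin (M i) × Fin (M i))
  set c' : (I → A) → Fin (Fintype.card (∀ i, Fin (M i) × Fin (M i))) :=
    fun x => e fun i => c i (x i) with hc'
  have hcm : Measurable c' := (Measurable.of_discrete (f := e)).comp
    (measurable_pi_lambda _ fun i => (hc i).comp (measurable_pi_apply i))
  refine ⟨_, c', hcm, fun g hg hK => ?_⟩
  obtain ⟨x₀⟩ := nonempty_of_isProbabilityMeasure ν
  have hK0 : -K ≤ K := by have := abs_le.1 (hK x₀); linarith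
  -- The supremum of `g` over configurations below `y` extends `g` monotonically to all extended
  -- real arguments; `-K` covers the case where there are none.
  set V : (I → EReal) → Set ℝ := fun y => insert (-K) (g '' {x | ∀ i, ι i (x i) ≤ y i}) with hV
  have hVK : ∀ y, ∀ v ∈ V y, v ≤ K := by
    rintro y v (rfl | ⟨x, -, rfl⟩)
    · exact hK0
    · exact (abs_le.1 (hK x)).2
  have hVne : ∀ y, (V y).Nonempty := fun y => ⟨-K, Set.mem_insert _ _⟩
  have hVb : ∀ y, BddAbove (V y) := fun y => ⟨K, fun v hv => hVK y v hv⟩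
  set G : (I → EReal) → ℝ := fun y => sSup (V y) with hG
  have hGm : Monotone G := by
    intro y z hyz
    refine csSup_le_csSup (hVb z) (hVne y) (Set.insert_subset_insert (Set.image_mono ?_))
    intro x hx
    rw [Set.mem_ofPred_eq] at hx ⊢
    exact fun i => (hx i).trans (hyz i)
  have hGK : ∀ y, |G y| ≤ K := fun y => abs_le.2
    ⟨le_csSup (hVb y) (Set.mem_insert _ _), csSup_le (hVne y) (hVK y)⟩
  have hGg : ∀ x : I → A, G (fun i => ι i (x i)) = g x := by
    intro x
    refine le_antisymm (csSup_le (hVne _) ?_) (le_csSup (hVb _) (Or.inr ⟨x, ?_, rfl⟩))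
    · rintro v (rfl | ⟨z, hz, rfl⟩)
      · exact (abs_le.1 (hK x)).1
      · rw [Set.mem_ofPred_eq] at hz
        exact hg _ _ fun i => EReal.coe_le_coe_iff.1 (hz i)
    · rw [Set.mem_ofPred_eq]; exact fun i => le_rfl
  set l := fun j => G fun i => lo i (e.symm j i) with hl
  set u := fun j => G fun i => hi i (e.symm j i) with hu
  have hlc : ∀ x, l (c' x) = G fun i => lo i (c i (x i)) := fun x => by simp [hl, hc']
  have huc : ∀ x, u (c' x) = G fun i => hi i (c i (x i)) := fun x => by simp [hu, hc']
  have hbr : ∀ x, l (c' x) ≤ g x ∧ g x ≤ u (c' x) := by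
    intro x
    rw [hlc, huc, ← hGg]
    exact ⟨hGm fun i => (hb i _).1, hGm fun i => (hb i _).2⟩
  refine ⟨l, u, fun j => hGK _, fun j => hGK _, hbr, ?_⟩
  have hmF : Measurable fun j => ENNReal.ofReal (u j - l j) := Measurable.of_discrete
  have h1 : ∫⁻ x, ENNReal.ofReal (u (c' x) - l (c' x)) ∂ν ≤ ENNReal.ofReal ε := by
    refine hF _ (hmF.comp hcm) (fun x => ENNReal.ofReal_le_ofReal ?_) ?_
    · have h1 := (abs_le.1 (hGK fun i => lo i (e.symm (c' x) i))).1
      have h2 := (abs_le.1 (hGK fun i => hi i (e.symm (c' x) i))).2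
      simp only [hl, hu]
      linarith
    · simp_rw [hlc, huc]
      exact hint G hGm hGK
  rw [← lintegral_map hmF hcm, lintegral_fintype] at h1
  have h2 : ENNReal.ofReal (∑ j, (u j - l j) * ν.real (c' ⁻¹' {j})) ≤ ENNReal.ofReal ε := by
    refine le_trans (le_of_eq ?_) h1
    rw [ENNReal.ofReal_sum_of_nonneg]
    · refine Finset.sum_congr rfl fun j _ => ?_
      rw [ENNReal.ofReal_mul' measureReal_nonneg, ofReal_measureReal,
        Measure.map_apply hcm (measurableSet_singleton j)]
    · intro j _
      -- A code that is never attained may have `u j < l j`, but its weight is zero.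
      rcases (c' ⁻¹' {j}).eq_empty_or_nonempty with h0 | ⟨x, hx⟩
      · simp [h0]
      · have hxj : c' x = j := hx
        have := hbr x
        rw [hxj] at this
        exact mul_nonneg (by linarith) measureReal_nonneg
  exact (ENNReal.ofReal_le_ofReal_iff hε.le).1 h2

/-! ### Independence over distant sets -/

lemma latticeDist_comm {d : ℕ} (x y : Site d) : latticeDist x y = latticeDist y x := by
  unfold latticeDist
  exact Finset.sum_congr rfl fun i _ => by omega

lemma disjoint_of_lt_latticeDist {d : ℕ} {r : ℕ} {S T : Finset (Site d)}
    (h : ∀ x ∈ S, ∀ y ∈ T, r < latticeDist x y) : Disjoint S T := by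
  refine Finset.disjoint_left.2 fun x hx hy => ?_
  have := h x hx x hy
  simp [latticeDist] at this

lemma card_cube (d n : ℕ) : (cube d n).card = n ^ d := by
  simp [cube, Fintype.card_piFinset]

/-- Tonelli, after identifying `A^(S ∪ T)` with `A^S × A^T`. The set `U` is kept separate from `S ∪
T` because (M3) supplies it as a `biUnion`. -/
lemma lintegral_refMeasure_union {d : ℕ} {A : Set ℝ} (μ : Site d → Measure A)
    [∀ z, SigmaFinite (μ z)] {S T U : Finset (Site d)} (hU : U = S ∪ T) (hST : Disjoint S T)
    (hS : S ⊆ U) (hT : T ⊆ U) {F : (S → A) → ENNReal} {G : (T → A) → ENNReal}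
    (hF : Measurable F) (hG : Measurable G) :
    ∫⁻ ω, F (Finset.restrict₂ (π := fun _ => A) hS ω) *
        G (Finset.restrict₂ (π := fun _ => A) hT ω) ∂(refMeasure μ U) =
      (∫⁻ x, F x ∂(refMeasure μ S)) * ∫⁻ y, G y ∂(refMeasure μ T) := by
  subst hU
  have hmp := measurePreserving_piFinsetUnion hST μ
  unfold refMeasure
  have hm : Measurable fun ω : (↥(S ∪ T) → A) =>
      F (Finset.restrict₂ (π := fun _ => A) hS ω) *
        G (Finset.restrict₂ (π := fun _ => A) hT ω) :=
    (hF.comp (Finset.measurable_restrict₂ hS)).mul (hG.comp (Finset.measurable_restrict₂ hT))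
  rw [← hmp.lintegral_comp hm, ← lintegral_prod_mul hF.aemeasurable hG.aemeasurable]
  refine lintegral_congr fun z => ?_
  have e1 : Finset.restrict₂ (π := fun _ => A) hS
      (MeasurableEquiv.piFinsetUnion (fun _ => A) hST z) = z.1 := by
    ext ⟨x, hx⟩
    exact congrArg Subtype.val (Equiv.piFinsetUnion_left (fun _ => A) hST hx (hS hx))
  have e2 : Finset.restrict₂ (π := fun _ => A) hT
      (MeasurableEquiv.piFinsetUnion (fun _ => A) hST z) = z.2 := by
    ext ⟨x, hx⟩
    exact congrArg Subtype.val (Equiv.piFinsetUnion_right (fun _ => A) hST hx (hT hx))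
  rw [e1, e2]

/-- Restrictions of the colouring to two distant finite sets are independent. -/
lemma measure_restrict_inter_restrict {d : ℕ} {A : Set ℝ} {P : Measure (Config d A)}
    [IsProbabilityMeasure P] {μ : Site d → Measure A} {r : ℕ} (h2 : HasMarginalDensities P μ)
    (h3 : IndependentAtDistance P μ r) {S T : Finset (Site d)} (hS : S.Nonempty)
    (hT : T.Nonempty) (hST : ∀ x ∈ S, ∀ y ∈ T, r < latticeDist x y)
    {B : Set (S → A)} {C : Set (T → A)} (hB : MeasurableSet B) (hC : MeasurableSet C) :
    P ((S.restrict (π := fun _ => A)) ⁻¹' B ∩ (T.restrict (π := fun _ => A)) ⁻¹' C) =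
      P ((S.restrict (π := fun _ => A)) ⁻¹' B) * P ((T.restrict (π := fun _ => A)) ⁻¹' C) := by
  classical
  have hsf : ∀ z, SigmaFinite (μ z) := h2.1
  have hrS : ∀ Λ : Finset (Site d), Measurable (Λ.restrict (π := fun _ => A)) :=
    fun Λ => Finset.measurable_restrict Λ
  have hfin : ∀ Λ, IsProbabilityMeasure (marginal P Λ) := fun Λ =>
    Measure.isProbabilityMeasure_map (hrS Λ).aemeasurable
  have hsfr : ∀ Λ, SigmaFinite (refMeasure μ Λ) := fun Λ => by
    unfold refMeasure; infer_instance
  -- Two sets suffice here; larger families follow by induction.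
  set L : Fin 2 → Finset (Site d) := ![S, T] with hL
  set U := Finset.univ.biUnion L with hUdef
  have hU : U = S ∪ T := by
    ext x; simp [hUdef, hL]
  have hSU : S ⊆ U := Finset.subset_biUnion_of_mem L (Finset.mem_univ 0)
  have hTU : T ⊆ U := Finset.subset_biUnion_of_mem L (Finset.mem_univ 1)
  have hfac := h3 2 L (by intro j; fin_cases j <;> simpa [hL]) (by
    intro i j hij x hx y hy
    fin_cases i <;> fin_cases j
    · exact absurd rfl hij
    · exact hST x hx y hy
    · rw [latticeDist_comm]; exact hST y hy x hx
    · exact absurd rfl hij)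
  have hρ : ∀ (Λ : Finset (Site d)) {D : Set (Λ → A)}, MeasurableSet D →
      P ((Λ.restrict (π := fun _ => A)) ⁻¹' D) =
        ∫⁻ x, D.indicator (marginalDensity P μ Λ) x ∂(refMeasure μ Λ) := by
    intro Λ D hD
    rw [lintegral_indicator hD, marginalDensity, Measure.setLIntegral_rnDeriv (h2.2 Λ), marginal,
      Measure.map_apply (hrS Λ) hD]
  have hρm : ∀ Λ, Measurable (marginalDensity P μ Λ) := fun Λ => Measure.measurable_rnDeriv _ _
  set D : Set (U → A) := (Finset.restrict₂ (π := fun _ => A) hSU) ⁻¹' B ∩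
    (Finset.restrict₂ (π := fun _ => A) hTU) ⁻¹' C with hD
  have hDm : MeasurableSet D :=
    (Finset.measurable_restrict₂ hSU hB).inter (Finset.measurable_restrict₂ hTU hC)
  have hpre : (S.restrict (π := fun _ => A)) ⁻¹' B ∩ (T.restrict (π := fun _ => A)) ⁻¹' C =
      (U.restrict (π := fun _ => A)) ⁻¹' D := rfl
  rw [hpre, hρ U hDm, hρ S hB, hρ T hC,
    ← lintegral_refMeasure_union μ hU (disjoint_of_lt_latticeDist hST) hSU hTU
      ((hρm S).indicator hB) ((hρm T).indicator hC)]
  refine lintegral_congr_ae ?_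
  filter_upwards [hfac] with ω hω
  rw [Set.mem_ofPred_eq, Fin.prod_univ_two] at hω
  by_cases h1 : Finset.restrict₂ (π := fun _ => A) hSU ω ∈ B
  · by_cases h2 : Finset.restrict₂ (π := fun _ => A) hTU ω ∈ C
    · rw [Set.indicator_of_mem (show ω ∈ D from ⟨h1, h2⟩), Set.indicator_of_mem h1,
        Set.indicator_of_mem h2, hω]
      rfl
    · rw [Set.indicator_of_notMem (fun h : ω ∈ D => h2 h.2), Set.indicator_of_notMem h2, mul_zero]
  · rw [Set.indicator_of_notMem (fun h : ω ∈ D => h1 h.1), Set.indicator_of_notMem h1, zero_mul]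

/-- Restrictions of the colouring to mutually distant finite sets are independent. -/
lemma iIndepFun_restrict {d : ℕ} {A : Set ℝ} {P : Measure (Config d A)}
    [IsProbabilityMeasure P] {μ : Site d → Measure A} {r : ℕ} (h2 : HasMarginalDensities P μ)
    (h3 : IndependentAtDistance P μ r) {ι : Type*} (L : ι → Finset (Site d))
    (hne : ∀ t, (L t).Nonempty)
    (hfar : ∀ t t', t ≠ t' → ∀ x ∈ L t, ∀ y ∈ L t', r < latticeDist x y) :
    ProbabilityTheory.iIndepFun (fun t => (L t).restrict (π := fun _ => A)) P := by
  classical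
  rw [ProbabilityTheory.iIndepFun_iff_measure_inter_preimage_eq_mul]
  intro S sets
  induction S using Finset.induction_on with
  | empty => simp
  | insert t S ht ih =>
    intro hs
    rw [Finset.set_biInter_insert, Finset.prod_insert ht]
    rw [← ih fun i hi => hs i (Finset.mem_insert_of_mem hi)]
    rcases S.eq_empty_or_nonempty with rfl | hS
    · simp
    -- The remaining sets are merged into one, still at distance more than `r` from `L t`.
    set V := S.biUnion L with hV
    have hsub : ∀ i : S, L i ⊆ V := fun i => Finset.subset_biUnion_of_mem L i.2
    have hC : MeasurableSet (⋂ i : S, (Finset.restrict₂ (π := fun _ => A) (hsub i)) ⁻¹' sets i) :=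
      MeasurableSet.iInter fun i =>
        Finset.measurable_restrict₂ (hsub i) (hs i (Finset.mem_insert_of_mem i.2))
    have hpre : (⋂ i ∈ S, ((L i).restrict (π := fun _ => A)) ⁻¹' sets i) =
        (V.restrict (π := fun _ => A)) ⁻¹'
          (⋂ i : S, (Finset.restrict₂ (π := fun _ => A) (hsub i)) ⁻¹' sets i) := by
      ext ω
      simp only [Set.mem_iInter, Set.mem_preimage, Subtype.forall]
      rfl
    rw [hpre]
    refine measure_restrict_inter_restrict h2 h3 (hne t) (hS.biUnion fun i _ => hne i) ?_
      (hs t (Finset.mem_insert_self _ _)) hC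
    intro x hx y hy
    obtain ⟨i, hi, hyi⟩ := Finset.mem_biUnion.1 hy
    exact hfar t i (fun h => ht (h ▸ hi)) x hx y hyi

/-! ### Law of large numbers along cubes -/

/-- Hoeffding bounds the exceptional probability by `exp (-2 η² k^d)`. Since `d ≥ 1`, this is at
most a summable geometric term in `k`, and Borel–Cantelli applies. -/
lemma ae_eventually_sum_cube_lt {d : ℕ} (hd : 1 ≤ d) {Ω : Type*} [MeasurableSpace Ω]
    {P : Measure Ω} [IsProbabilityMeasure P] {X : Site d → Ω → ℝ} {p : ℝ}
    (hX : ∀ t, Measurable (X t)) (hX01 : ∀ t ω, X t ω ∈ Set.Icc (0 : ℝ) 1)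
    (hp : ∀ t, ∫ ω, X t ω ∂P = p) (hind : ProbabilityTheory.iIndepFun X P) {η : ℝ} (hη : 0 < η) :
    ∀ᵐ ω ∂P, ∀ᶠ k : ℕ in atTop, ∑ t ∈ cube d k, (X t ω - p) < η * (k : ℝ) ^ d := by
  set Z : Site d → Ω → ℝ := fun t ω => X t ω - p with hZ
  have hZi : ProbabilityTheory.iIndepFun Z P :=
    hind.comp (fun _ x => x - p) fun _ => measurable_id.sub_const p
  have hsub : ∀ t, ProbabilityTheory.HasSubgaussianMGF (Z t) ((‖(1 : ℝ) - 0‖₊ / 2) ^ 2) P := by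
    intro t
    have := ProbabilityTheory.hasSubgaussianMGF_of_mem_Icc (hX t).aemeasurable
      (Eventually.of_forall (hX01 t)) (μ := P)
    rwa [hp t] at this
  have hbound : ∀ k : ℕ, P {ω | η * (k : ℝ) ^ d ≤ ∑ t ∈ cube d k, Z t ω} ≤
      ENNReal.ofReal (Real.exp (-(2 * η ^ 2)) ^ k) := by
    intro k
    have hk := ProbabilityTheory.HasSubgaussianMGF.measure_sum_ge_le_of_iIndepFun hZi
      (s := cube d k) (fun t _ => hsub t) (ε := η * (k : ℝ) ^ d) (by positivity)
    rw [← ofReal_measureReal]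
    refine ENNReal.ofReal_le_ofReal (hk.trans ?_)
    rw [← Real.exp_nat_mul]
    refine Real.exp_le_exp.2 ?_
    rcases Nat.eq_zero_or_pos k with rfl | hk0
    · have hd0 : d ≠ 0 := by omega
      simp [hd0]
    · have hk1 : (1 : ℝ) ≤ k := by exact_mod_cast hk0
      have hkd : (k : ℝ) ≤ (k : ℝ) ^ d := le_self_pow₀ hk1 (by omega)
      have hkp : (0 : ℝ) < (k : ℝ) ^ d := by positivity
      have e : -(η * (k : ℝ) ^ d) ^ 2 /
          (2 * ((∑ _i ∈ cube d k, (‖(1 : ℝ) - 0‖₊ / 2) ^ 2 : NNReal) : ℝ)) =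
          -(2 * η ^ 2) * (k : ℝ) ^ d := by
        simp only [Finset.sum_const, card_cube, sub_zero, nnnorm_one]
        push_cast
        simp only [nsmul_eq_mul]
        push_cast
        field_simp
      rw [e]
      nlinarith [sq_nonneg η]
  have hsum : ∑' k : ℕ, P {ω | η * (k : ℝ) ^ d ≤ ∑ t ∈ cube d k, Z t ω} ≠ ⊤ := by
    refine ne_top_of_le_ne_top ?_ (ENNReal.tsum_le_tsum hbound)
    have hs : Summable fun k : ℕ => Real.exp (-(2 * η ^ 2)) ^ k :=
      summable_geometric_of_lt_one (Real.exp_pos _).le (Real.exp_lt_one_iff.2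
        (by nlinarith [sq_pos_of_pos hη]))
    exact hs.tsum_ofReal_ne_top
  filter_upwards [ae_eventually_notMem hsum] with ω hω
  filter_upwards [hω] with k hk
  exact not_le.1 fun h => hk h

/-- The strong law of large numbers along the cubes `[0,k)^d` for independent variables with values
in the unit interval. -/
lemma ae_tendsto_average_cube {d : ℕ} (hd : 1 ≤ d) {Ω : Type*} [MeasurableSpace Ω]
    {P : Measure Ω} [IsProbabilityMeasure P] {X : Site d → Ω → ℝ} {p : ℝ}
    (hX : ∀ t, Measurable (X t)) (hX01 : ∀ t ω, X t ω ∈ Set.Icc (0 : ℝ) 1)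
    (hp : ∀ t, ∫ ω, X t ω ∂P = p) (hind : ProbabilityTheory.iIndepFun X P) :
    ∀ᵐ ω ∂P, Tendsto (fun k : ℕ => ((k : ℝ) ^ d)⁻¹ * ∑ t ∈ cube d k, X t ω) atTop (𝓝 p) := by
  have hu : ∀ᵐ ω ∂P, ∀ i : ℕ, ∀ᶠ k : ℕ in atTop,
      ∑ t ∈ cube d k, (X t ω - p) < (1 / ((i : ℝ) + 1)) * (k : ℝ) ^ d :=
    ae_all_iff.2 fun i => ae_eventually_sum_cube_lt hd hX hX01 hp hind (by positivity)
  -- The lower deviation is the upper deviation of `1 - X`.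
  have hl : ∀ᵐ ω ∂P, ∀ i : ℕ, ∀ᶠ k : ℕ in atTop,
      ∑ t ∈ cube d k, ((1 - X t ω) - (1 - p)) < (1 / ((i : ℝ) + 1)) * (k : ℝ) ^ d := by
    refine ae_all_iff.2 fun i => ae_eventually_sum_cube_lt hd (X := fun t ω => 1 - X t ω)
      (fun t => (hX t).const_sub 1)
      (fun t ω => ⟨by linarith [(hX01 t ω).2], by linarith [(hX01 t ω).1]⟩) (fun t => ?_)
      (hind.comp (fun _ x => 1 - x) fun _ => measurable_id.const_sub 1) (by positivity)
    have hint : Integrable (X t) P := Integrable.of_bound (hX t).aestronglyMeasurable 1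
      (Eventually.of_forall fun ω => by
        rw [Real.norm_eq_abs, abs_of_nonneg (hX01 t ω).1]; exact (hX01 t ω).2)
    rw [integral_sub (integrable_const _) hint, hp t]
    simp
  filter_upwards [hu, hl] with ω h1 h2
  rw [Metric.tendsto_atTop']
  intro ε hε
  obtain ⟨i, hi⟩ := exists_nat_one_div_lt hε
  obtain ⟨k0, hk0⟩ := eventually_atTop.1 ((h1 i).and (h2 i))
  refine ⟨k0, fun k hk => ?_⟩
  obtain ⟨g1, g2⟩ := hk0 k hk.le
  have hkpos : (0 : ℝ) < (k : ℝ) ^ d := by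
    have : (0 : ℝ) < k := by exact_mod_cast (by omega : 0 < k)
    positivity
  have hcard : ((cube d k).card : ℝ) = (k : ℝ) ^ d := by rw [card_cube]; push_cast; rfl
  simp only [Finset.sum_sub_distrib, Finset.sum_const, nsmul_eq_mul, hcard, mul_one] at g1 g2
  rw [Real.dist_eq, show ((k : ℝ) ^ d)⁻¹ * ∑ t ∈ cube d k, X t ω - p =
    ((k : ℝ) ^ d)⁻¹ * (∑ t ∈ cube d k, X t ω - (k : ℝ) ^ d * p) by field_simp, abs_mul,
    abs_of_pos (inv_pos.2 hkpos), inv_mul_lt_iff₀ hkpos]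
  have : (1 / ((i : ℝ) + 1)) * (k : ℝ) ^ d < (k : ℝ) ^ d * ε := by
    rw [mul_comm]; exact mul_lt_mul_of_pos_left hi hkpos
  rw [abs_lt]
  constructor <;> linarith

/-! ### Admissible functions: order, linear growth, decomposition -/

/-- Pass from `ω` to `ω'` on `Λ` site by site; each change is monotone in the direction given by
`s`, and by locality the sites outside `Λ` do not matter. -/
lemma IsAdmissible.le_of_forall_le {d : ℕ} {A : Set ℝ} {f : Finset (Site d) → Config d A → RCB}
    (hf : IsAdmissible f) : ∃ s : Site d → ℤˣ, ∀ (Λ : Finset (Site d)) (ω ω' : Config d A) (E : ℝ),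
      (∀ x ∈ Λ, ((s x : ℤ) : ℝ) * ω x ≤ ((s x : ℤ) : ℝ) * ω' x) →
        (f Λ ω).1 E ≤ (f Λ ω').1 E := by
  classical
  obtain ⟨s, hs⟩ := hf.monotone
  refine ⟨s, fun Λ ω ω' E h => ?_⟩
  have key : ∀ T : Finset (Site d), T ⊆ Λ → (f Λ ω).1 E ≤ (f Λ (T.piecewise ω' ω)).1 E := by
    intro T
    induction T using Finset.induction_on with
    | empty => intro _; simp
    | insert z T hz ih =>
      intro hT
      have hzΛ := hT (Finset.mem_insert_self z T)
      refine (ih fun x hx => hT (Finset.mem_insert_of_mem hx)).trans ?_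
      have hoff : ∀ x ∈ Λ, x ≠ z → T.piecewise ω' ω x = (insert z T).piecewise ω' ω x := by
        intro x _ hx
        simp [Finset.piecewise, hx]
      have e1 : T.piecewise ω' ω z = ω z := Finset.piecewise_eq_of_notMem _ _ _ hz
      have e2 : (insert z T).piecewise ω' ω z = ω' z :=
        Finset.piecewise_eq_of_mem _ _ _ (Finset.mem_insert_self _ _)
      have hzz := h z hzΛ
      rcases Int.units_eq_one_or (s z) with h1 | h1
      · rw [h1] at hzz
        refine (hs Λ _ _ z hzΛ E hoff ?_).1 h1
        rw [e1, e2, ← Subtype.coe_le_coe]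
        simpa using hzz
      · rw [h1] at hzz
        refine (hs Λ _ _ z hzΛ E (fun x hx hxz => (hoff x hx hxz).symm) ?_).2 h1
        rw [e1, e2, ← Subtype.coe_le_coe]
        simpa using hzz
  refine (key Λ subset_rfl).trans (le_of_eq ?_)
  rw [hf.is_local Λ _ ω' fun x hx => Finset.piecewise_eq_of_mem _ _ _ hx]

section BoundaryTerm

variable {d : ℕ} {A : Set ℝ} {f : Finset (Site d) → Config d A → RCB} {b : Finset (Site d) → ℝ}

/-- The empty set is disjoint from itself, so two copies give `‖f ∅ ω‖ ≤ 2 * b ∅`, and the linear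
bound forces `b ∅ ≤ 0`. -/
lemma IsBoundaryTerm.map_empty (hb : IsBoundaryTerm f b) (ω : Config d A) : f ∅ ω = 0 := by
  obtain ⟨D, -, hD⟩ := hb.linear_bound
  have h0 : b ∅ ≤ 0 := by simpa using hD ∅
  have h := hb.almost_additive ω 2 two_pos (fun _ => ∅) fun _ _ _ => Finset.disjoint_empty_left _
  have e : (Finset.univ : Finset (Fin 2)).biUnion (fun _ => (∅ : Finset (Site d))) = ∅ := by
    ext; simp
  rw [e, Fin.sum_univ_two, Fin.sum_univ_two] at h
  have h' : ‖f ∅ ω‖ ≤ 0 := by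
    calc ‖f ∅ ω‖ = ‖f ∅ ω - (f ∅ ω + f ∅ ω)‖ := by rw [sub_add_cancel_left, norm_neg]
      _ ≤ 0 := by linarith
  exact norm_le_zero_iff.1 h'

lemma IsBoundaryTerm.norm_biUnion_sub_sum_le (hb : IsBoundaryTerm f b) (ω : Config d A)
    {ι : Type*} (S : Finset ι) (L : ι → Finset (Site d))
    (hL : ∀ i ∈ S, ∀ j ∈ S, i ≠ j → Disjoint (L i) (L j)) :
    ‖f (S.biUnion L) ω - ∑ i ∈ S, f (L i) ω‖ ≤ ∑ i ∈ S, b (L i) := by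
  classical
  rcases S.eq_empty_or_nonempty with rfl | hS
  · simp [hb.map_empty]
  have h := hb.almost_additive ω S.card hS.card_pos (fun i => L (S.equivFin.symm i))
    fun i j hij => hL _ (S.equivFin.symm i).2 _ (S.equivFin.symm j).2
      fun h => hij (S.equivFin.symm.injective (Subtype.ext h))
  have e : (Finset.univ.biUnion fun i => L (S.equivFin.symm i)) = S.biUnion L := by
    ext x
    simp only [Finset.mem_biUnion, Finset.mem_univ, true_and]
    constructor
    · rintro ⟨i, hi⟩; exact ⟨_, (S.equivFin.symm i).2, hi⟩
    · rintro ⟨i, hi, hx⟩; exact ⟨S.equivFin ⟨i, hi⟩, by simpa using hx⟩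
  rw [e, Equiv.sum_comp S.equivFin.symm (fun i : S => f (L i) ω),
    Equiv.sum_comp S.equivFin.symm (fun i : S => b (L i)), Finset.sum_coe_sort S
      (fun i => f (L i) ω), Finset.sum_coe_sort S (fun i => b (L i))] at h
  exact h

lemma exists_norm_add_le_mul_card (hf : IsAdmissible f) (hb : IsBoundaryTerm f b) :
    ∃ C : ℝ, 0 ≤ C ∧ ∀ (Λ : Finset (Site d)) (ω : Config d A), ‖f Λ ω‖ + b Λ ≤ C * Λ.card := by
  obtain ⟨D, hD0, hD⟩ := hb.linear_bound
  obtain ⟨C, hC⟩ := hf.bounded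
  -- Splitting `Λ` into single sites costs `max C 0` per site for the values and `D` for the defect;
  -- the second `D` pays for `b Λ`.
  refine ⟨max C 0 + 2 * D, by positivity, fun Λ ω => ?_⟩
  have h := hb.norm_biUnion_sub_sum_le ω Λ (fun x => {x}) fun i _ j _ hij => by simpa using hij
  rw [Finset.biUnion_singleton_eq_self] at h
  have h1 : ∑ x ∈ Λ, b {x} ≤ D * Λ.card := by
    calc ∑ x ∈ Λ, b {x} ≤ ∑ _x ∈ Λ, D := Finset.sum_le_sum fun x _ => by simpa using hD {x}
      _ = D * Λ.card := by simp [mul_comm]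
  have h2 : ‖∑ x ∈ Λ, f {x} ω‖ ≤ max C 0 * Λ.card := by
    refine (norm_sum_le _ _).trans ?_
    calc ∑ x ∈ Λ, ‖f {x} ω‖ ≤ ∑ _x ∈ Λ, max C 0 := Finset.sum_le_sum fun x _ => by
          have : ({x} : Finset (Site d)) = translateSet {0} x := by simp [translateSet]
          rw [this, hf.translation_invariant]
          exact (hC _).trans (le_max_left _ _)
      _ = max C 0 * Λ.card := by simp [mul_comm]
  have h3 := norm_le_norm_add_norm_sub' (f Λ ω) (∑ x ∈ Λ, f {x} ω)
  have := hD Λ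
  linarith

lemma mem_cube {n : ℕ} {x : Site d} : x ∈ cube d n ↔ ∀ i, 0 ≤ x i ∧ x i < n := by
  simp [cube]

lemma mem_translateSet {Λ : Finset (Site d)} {z x : Site d} :
    x ∈ translateSet Λ z ↔ x - z ∈ Λ := by
  simp only [translateSet, Finset.mem_image]
  exact ⟨by rintro ⟨y, hy, rfl⟩; simpa using hy, fun h => ⟨_, h, sub_add_cancel _ _⟩⟩

lemma card_translateSet (Λ : Finset (Site d)) (z : Site d) : (translateSet Λ z).card = Λ.card :=
  Finset.card_image_of_injective _ (add_left_injective z)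

/-- Cubes of side length `q` placed at mesh `q + r` have mutual distance larger than `r`. -/
lemma lt_latticeDist_of_mem_translateSet_cube {q r : ℕ} {t t' : Site d} (h : t ≠ t')
    {x y : Site d} (hx : x ∈ translateSet (cube d q) (((q + r : ℕ) : ℤ) • t))
    (hy : y ∈ translateSet (cube d q) (((q + r : ℕ) : ℤ) • t')) : r < latticeDist x y := by
  obtain ⟨i, hi⟩ := Function.ne_iff.1 h
  have h1 := mem_cube.1 (mem_translateSet.1 hx) i
  have h2 := mem_cube.1 (mem_translateSet.1 hy) i
  simp only [Pi.sub_apply, Pi.smul_apply, smul_eq_mul] at h1 h2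
  refine lt_of_lt_of_le ?_ (Finset.single_le_sum (f := fun i => (y i - x i).natAbs)
    (fun _ _ => Nat.zero_le _) (Finset.mem_univ i))
  push_cast at h1 h2
  have hm : (0 : ℤ) ≤ (q : ℤ) + r := by positivity
  zify
  rw [lt_abs]
  rcases lt_or_gt_of_ne hi with h' | h'
  · left
    have : ((q : ℤ) + r) * (t i + 1) ≤ ((q : ℤ) + r) * t' i :=
      mul_le_mul_of_nonneg_left (by omega) hm
    linarith
  · right
    have : ((q : ℤ) + r) * (t' i + 1) ≤ ((q : ℤ) + r) * t i :=
      mul_le_mul_of_nonneg_left (by omega) hm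
    linarith

/-- Decomposition of a large cube into well separated small cubes and a remainder. -/
lemma norm_cube_sub_sum_le (hf : IsAdmissible f) (hb : IsBoundaryTerm f b) {C : ℝ}
    (hC : ∀ (Λ : Finset (Site d)) (ω : Config d A), ‖f Λ ω‖ + b Λ ≤ C * Λ.card) (ω : Config d A)
    {n k q r : ℕ} (hn : k * (q + r) ≤ n) :
    ‖f (cube d n) ω - ∑ t ∈ cube d k, f (cube d q) (shift (((q + r : ℕ) : ℤ) • t) ω)‖ ≤
      (k : ℝ) ^ d * b (cube d q) + C * ((n : ℝ) ^ d - (k : ℝ) ^ d * (q : ℝ) ^ d) := by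
  classical
  set B : Site d → Finset (Site d) := fun t => translateSet (cube d q) (((q + r : ℕ) : ℤ) • t)
    with hB
  have hBd : ∀ t t', t ≠ t' → Disjoint (B t) (B t') := fun t t' h =>
    disjoint_of_lt_latticeDist fun x hx y hy => lt_latticeDist_of_mem_translateSet_cube h hx hy
  have hBsub : (cube d k).biUnion B ⊆ cube d n := by
    intro x hx
    obtain ⟨t, ht, hxt⟩ := Finset.mem_biUnion.1 hx
    refine mem_cube.2 fun i => ?_
    have h1 := mem_cube.1 (mem_translateSet.1 hxt) i
    have h2 := mem_cube.1 ht i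
    simp only [Pi.sub_apply, Pi.smul_apply, smul_eq_mul] at h1
    push_cast at h1
    have hm : (0 : ℤ) ≤ (q : ℤ) + r := by positivity
    have h3 : ((q : ℤ) + r) * (t i + 1) ≤ ((q : ℤ) + r) * k :=
      mul_le_mul_of_nonneg_left (by omega) hm
    have h4 : (0 : ℤ) ≤ ((q : ℤ) + r) * t i := mul_nonneg hm h2.1
    have h5 : (k : ℤ) * (q + r) ≤ n := by exact_mod_cast hn
    constructor <;> nlinarith
  set R := cube d n \ (cube d k).biUnion B with hR
  -- `none` indexes the remainder, so that one application of almost additivity covers everything.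
  set L : Option (Site d) → Finset (Site d) := fun o => o.elim R B with hL
  have hU : (Finset.insertNone (cube d k)).biUnion L = cube d n := by
    rw [← Finset.sdiff_union_of_subset hBsub]
    ext x
    simp only [Finset.mem_biUnion, Finset.mem_union, Option.exists, hL, Option.elim,
      Finset.none_mem_insertNone, Finset.some_mem_insertNone, true_and, ← hR]
  have hRd : ∀ t ∈ cube d k, Disjoint R (B t) := fun t ht =>
    Finset.disjoint_of_subset_right (Finset.subset_biUnion_of_mem B ht) Finset.sdiff_disjoint
  have h := hb.norm_biUnion_sub_sum_le ω (Finset.insertNone (cube d k)) L (by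
    rintro (_ | t) ht (_ | t') ht' hne
    · exact absurd rfl hne
    · exact hRd t' (Finset.some_mem_insertNone.1 ht')
    · exact (hRd t (Finset.some_mem_insertNone.1 ht)).symm
    · exact hBd t t' fun h => hne (h ▸ rfl))
  rw [hU, Finset.sum_insertNone, Finset.sum_insertNone] at h
  simp only [hL, Option.elim] at h
  have e1 : ∀ t, f (B t) ω = f (cube d q) (shift (((q + r : ℕ) : ℤ) • t) ω) := fun t =>
    hf.translation_invariant _ _ _
  have e2 : ∀ t, b (B t) = b (cube d q) := fun t => hb.translate _ _
  simp only [e1, e2, Finset.sum_const, card_cube, nsmul_eq_mul] at h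
  have hcard : (R.card : ℝ) = (n : ℝ) ^ d - (k : ℝ) ^ d * (q : ℝ) ^ d := by
    rw [hR, Finset.card_sdiff_of_subset hBsub, Nat.cast_sub (Finset.card_le_card hBsub),
      Finset.card_biUnion fun t _ t' _ => hBd t t']
    simp [hB, card_translateSet, card_cube]
  -- One volume bound pays for both `f R ω` and `b R`.
  have hRC := hC R ω
  rw [hcard] at hRC
  push_cast at h
  set T := ∑ t ∈ cube d k, f (cube d q) (shift (((q : ℤ) + (r : ℤ)) • t) ω) with hT
  have h3 : ‖f (cube d n) ω - T‖ ≤ ‖f (cube d n) ω - (f R ω + T)‖ + ‖f R ω‖ := by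
    calc ‖f (cube d n) ω - T‖ = ‖(f (cube d n) ω - (f R ω + T)) + f R ω‖ := by congr 1; abel
      _ ≤ _ := norm_add_le _ _
  push_cast
  linarith

end BoundaryTerm

/-! ### The supremum norm and completeness -/

lemma abs_apply_le_norm (F : RCB) (E : ℝ) : |F.1 E| ≤ ‖F‖ :=
  lp.norm_apply_le_norm ENNReal.top_ne_zero F.1 E

lemma norm_le_of_forall_abs_le {F : RCB} {c : ℝ} (hc : 0 ≤ c) (h : ∀ E, |F.1 E| ≤ c) : ‖F‖ ≤ c :=
  lp.norm_le_of_forall_le hc h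

/-- Uniform limits preserve right continuity, so the subspace is closed in a complete space. -/
instance : CompleteSpace RCB := by
  refine IsClosed.completeSpace_coe (hs := isClosed_of_closure_subset fun F hF x => ?_)
  refine continuousWithinAt_of_locally_uniform_approx_of_continuousWithinAt Set.self_mem_Ici ?_
  intro u hu
  obtain ⟨ε, hε, hεu⟩ := Metric.mem_uniformity_dist.1 hu
  obtain ⟨G, hG, hFG⟩ := Metric.mem_closure_iff.1 hF ε hε
  refine ⟨Set.univ, univ_mem, fun y => G y, hG x, fun y _ => hεu ?_⟩
  rw [Real.dist_eq]
  refine lt_of_le_of_lt ?_ hFG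
  rw [dist_eq_norm]
  exact lp.norm_apply_le_norm ENNReal.top_ne_zero (F - G) y

/-! ### Uniform convergence of averages over separated cubes -/

/-- Averages of a bracketed function are controlled by the frequencies of the codes. -/
lemma abs_average_sub_le {J X T : Type*} [Fintype J] [DecidableEq J] {c : X → J} {g : X → ℝ}
    {l u p F : J → ℝ} {K ε η w : ℝ} (hl : ∀ j, |l j| ≤ K) (hu : ∀ j, |u j| ≤ K)
    (hg : ∀ x, l (c x) ≤ g x ∧ g x ≤ u (c x)) (hp : ∑ j, (u j - l j) * p j ≤ ε)
    (S : Finset T) (Y : T → X) (hw : 0 ≤ w)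
    (hF : ∀ j, F j = w * ∑ t ∈ S, if c (Y t) = j then 1 else 0)
    (hε : 0 ≤ ε) (hη : K * ∑ j, |F j - p j| ≤ η) :
    |w * ∑ t ∈ S, g (Y t) - ∑ j, u j * p j| ≤ ε + η := by
  have hcode : ∀ v : J → ℝ, w * ∑ t ∈ S, v (c (Y t)) = ∑ j, v j * F j := by
    intro v
    have h1 : ∀ t, v (c (Y t)) = ∑ j, v j * if c (Y t) = j then 1 else 0 := by
      intro t; simp
    simp_rw [h1, hF, Finset.mul_sum]
    rw [Finset.sum_comm]
    refine Finset.sum_congr rfl fun j _ => Finset.sum_congr rfl fun t _ => by ring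
  have hdiff : ∀ v : J → ℝ, (∀ j, |v j| ≤ K) → |∑ j, v j * F j - ∑ j, v j * p j| ≤ η := by
    intro v hv
    refine le_trans ?_ hη
    rw [← Finset.sum_sub_distrib, Finset.mul_sum]
    refine (Finset.abs_sum_le_sum_abs _ _).trans (Finset.sum_le_sum fun j _ => ?_)
    rw [← mul_sub, abs_mul]
    exact mul_le_mul_of_nonneg_right (hv j) (abs_nonneg _)
  have hu' := abs_le.1 (hdiff u hu)
  have hl' := abs_le.1 (hdiff l hl)
  have h1 : w * ∑ t ∈ S, g (Y t) ≤ ∑ j, u j * F j := by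
    rw [← hcode]
    exact mul_le_mul_of_nonneg_left (Finset.sum_le_sum fun t _ => (hg _).2) hw
  have h2 : ∑ j, l j * F j ≤ w * ∑ t ∈ S, g (Y t) := by
    rw [← hcode]
    exact mul_le_mul_of_nonneg_left (Finset.sum_le_sum fun t _ => (hg _).1) hw
  have h3 : ∑ j, (u j - l j) * p j = ∑ j, u j * p j - ∑ j, l j * p j := by
    rw [← Finset.sum_sub_distrib]
    exact Finset.sum_congr rfl fun j _ => by ring
  rw [abs_le]
  constructor <;> linarith

lemma measurable_shift {d : ℕ} {A : Set ℝ} (z : Site d) :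
    Measurable (shift z : Config d A → Config d A) :=
  measurable_pi_lambda _ fun x => measurable_pi_apply (x + z)

/-- The Glivenko–Cantelli property of the observables `f(Λ_q, ·)(E)`, uniformly in `E`, for the
empirical averages over the separated cubes. -/
lemma exists_ae_eventually_abs_average_sub_le {d : ℕ} (hd : 1 ≤ d) {A : Set ℝ}
    {P : Measure (Config d A)} [IsProbabilityMeasure P] {r : ℕ} (hP : SatisfiesM123 P r)
    {f : Finset (Site d) → Config d A → RCB} (hf : IsAdmissible f) {q : ℕ} (hq : 1 ≤ q)
    {K : ℝ} (hK : ∀ ω, ‖f (cube d q) ω‖ ≤ K) {η : ℝ} (hη : 0 < η) :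
    ∃ a : ℝ → ℝ, (∀ E, |a E| ≤ K) ∧ ∀ᵐ ω ∂P, ∀ᶠ k : ℕ in atTop, ∀ E : ℝ,
      |((k : ℝ) ^ d)⁻¹ * ∑ t ∈ cube d k,
        (f (cube d q) (shift (((q + r : ℕ) : ℤ) • t) ω)).1 E - a E| ≤ η := by
  classical
  obtain ⟨μ, h2, h3⟩ := hP.densities
  obtain ⟨s, hs⟩ := hf.le_of_forall_le
  obtain ⟨ω₀⟩ := nonempty_of_isProbabilityMeasure P
  have hsf : ∀ z, SigmaFinite (μ z) := h2.1
  set Λ := cube d q with hΛ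
  have hrΛ : Measurable (Λ.restrict (π := fun _ => A)) := Finset.measurable_restrict Λ
  have hprob : IsProbabilityMeasure (marginal P Λ) :=
    Measure.isProbabilityMeasure_map hrΛ.aemeasurable
  obtain ⟨n, c, hc, hbr⟩ := exists_finite_bracketing (fun i : Λ => s i) (fun i : Λ => μ i)
    (marginal P Λ) (h2.2 Λ) K (half_pos hη)
  -- Any filling outside `Λ` will do, by locality.
  set ext : (Λ → A) → Config d A := fun x z => if h : z ∈ Λ then x ⟨z, h⟩ else ω₀ z with hext
  have hext_mem : ∀ (x : Λ → A) (i : Λ), ext x i = x i := fun x i => by simp [hext]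
  have hbrE : ∀ E : ℝ, ∃ l u : Fin n → ℝ, (∀ j, |l j| ≤ K) ∧ (∀ j, |u j| ≤ K) ∧
      (∀ x, l (c x) ≤ (f Λ (ext x)).1 E ∧ (f Λ (ext x)).1 E ≤ u (c x)) ∧
        ∑ j, (u j - l j) * (marginal P Λ).real (c ⁻¹' {j}) ≤ η / 2 := by
    intro E
    refine hbr (fun x => (f Λ (ext x)).1 E) (fun x y hxy => ?_)
      fun x => (abs_apply_le_norm _ _).trans (hK _)
    refine hs Λ _ _ E fun z hz => ?_
    have := hxy ⟨z, hz⟩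
    rwa [hext_mem x ⟨z, hz⟩, hext_mem y ⟨z, hz⟩]
  choose l u hl hu hlu hint using hbrE
  set p : Fin n → ℝ := fun j => (marginal P Λ).real (c ⁻¹' {j}) with hp
  have hp1 : ∑ j, p j = 1 := by
    have h := sum_measureReal_preimage_singleton (μ := marginal P Λ) (Finset.univ : Finset (Fin n))
      (f := c) (fun j _ => hc (measurableSet_singleton j))
    rw [hp, h]
    simp
  set Y : Site d → Config d A → Λ → A :=
    fun t ω => Λ.restrict (π := fun _ => A) (shift (((q + r : ℕ) : ℤ) • t) ω) with hY
  have hYm : ∀ t, Measurable (Y t) := fun t => hrΛ.comp (measurable_shift _)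
  have hYind : ProbabilityTheory.iIndepFun Y P := by
    have h0 : (0 : Site d) ∈ Λ := mem_cube.2 fun i => ⟨le_rfl, by simp; omega⟩
    have hi := iIndepFun_restrict h2 h3
      (fun t : Site d => translateSet Λ (((q + r : ℕ) : ℤ) • t))
      (fun t => ⟨0 + ((q + r : ℕ) : ℤ) • t, mem_translateSet.2 (by simpa using h0)⟩)
      (fun t t' h x hx y hy => lt_latticeDist_of_mem_translateSet_cube h hx hy)
    exact hi.comp (fun t y (x : Λ) =>
        y ⟨x + ((q + r : ℕ) : ℤ) • t, mem_translateSet.2 (by simp)⟩)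
      fun t => measurable_pi_lambda _ fun x => measurable_pi_apply _
  have hlaw : ∀ t, P.map (Y t) = marginal P Λ := fun t => by
    rw [hY, marginal]
    conv_rhs => rw [← hP.translationInvariant (((q + r : ℕ) : ℤ) • t),
      Measure.map_map hrΛ (measurable_shift _)]
    rfl
  -- The coding `c` was fixed before `E`, so a single null set serves all `E`.
  have hlln : ∀ᵐ ω ∂P, ∀ j, Tendsto (fun k : ℕ => ((k : ℝ) ^ d)⁻¹ *
      ∑ t ∈ cube d k, if c (Y t ω) = j then (1 : ℝ) else 0) atTop (𝓝 (p j)) := by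
    refine ae_all_iff.2 fun j => ?_
    have hφ : Measurable fun x : Λ → A => if c x = j then (1 : ℝ) else 0 :=
      (Measurable.of_discrete (f := fun i : Fin n => if i = j then (1 : ℝ) else 0)).comp hc
    refine ae_tendsto_average_cube hd (X := fun t ω => if c (Y t ω) = j then (1 : ℝ) else 0)
      (fun t => hφ.comp (hYm t)) (fun t ω => ?_) (fun t => ?_) (hYind.comp _ fun _ => hφ)
    · split_ifs <;> simp
    · rw [← integral_map (hYm t).aemeasurable hφ.aestronglyMeasurable (f := fun x : Λ → A =>
        if c x = j then (1 : ℝ) else 0), hlaw t]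
      rw [hp]
      dsimp only
      rw [← integral_indicator_one (hc (measurableSet_singleton j))]
      refine integral_congr_ae (Eventually.of_forall fun x => ?_)
      simp [Set.indicator_apply]
  -- The mean of the upper bracket replaces the expectation of `f`, which avoids any measurability
  -- of `f`. Half of `η` goes to the bracket gap, half to the code frequencies.
  refine ⟨fun E => ∑ j, u E j * p j, fun E => ?_, ?_⟩
  · calc |∑ j, u E j * p j| ≤ ∑ j, |u E j * p j| := Finset.abs_sum_le_sum_abs _ _
      _ ≤ ∑ j, K * p j := Finset.sum_le_sum fun j _ => by
          rw [abs_mul, abs_of_nonneg (show 0 ≤ p j from measureReal_nonneg)]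
          exact mul_le_mul_of_nonneg_right (hu E j) measureReal_nonneg
      _ = K := by rw [← Finset.mul_sum, hp1, mul_one]
  · filter_upwards [hlln] with ω hω
    have hlim : Tendsto (fun k : ℕ => K * ∑ j, |((k : ℝ) ^ d)⁻¹ *
        (∑ t ∈ cube d k, if c (Y t ω) = j then (1 : ℝ) else 0) - p j|) atTop (𝓝 0) := by
      have := (tendsto_finsetSum Finset.univ fun j _ =>
        ((hω j).sub_const (p j)).abs).const_mul K
      simpa using this
    filter_upwards [hlim.eventually (ge_mem_nhds (half_pos hη))] with k hk E
    have h := abs_average_sub_le (hl E) (hu E) (hlu E) (hint E) (cube d k) (fun t => Y t ω)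
      (by positivity : (0 : ℝ) ≤ ((k : ℝ) ^ d)⁻¹) (fun j => rfl)
      (half_pos hη).le hk
    rw [add_halves] at h
    refine le_trans (le_of_eq ?_) h
    congr 3
    refine Finset.sum_congr rfl fun t _ => ?_
    rw [hf.is_local Λ _ (ext (Y t ω)) fun x hx => (hext_mem (Y t ω) ⟨x, hx⟩).symm]

/-! ### From separated cubes to large cubes, and the limit -/

lemma tendsto_natDiv_div (m : ℕ) :
    Tendsto (fun n : ℕ => ((n / m : ℕ) : ℝ) / n) atTop (𝓝 (1 / (m : ℝ))) := by
  have h := (tendsto_nat_floor_mul_div_atTop (R := ℝ) (a := 1 / (m : ℝ)) (by positivity)).comp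
    tendsto_natCast_atTop_atTop
  refine h.congr fun n => ?_
  simp only [Function.comp]
  rw [one_div_mul_eq_div, Nat.floor_div_eq_div]

/-- Up to any error, the averages over large cubes are almost surely uniformly close to a
deterministic function. -/
lemma exists_ae_eventually_abs_cube_sub_le {d : ℕ} (hd : 1 ≤ d) {A : Set ℝ}
    {P : Measure (Config d A)} [IsProbabilityMeasure P] {r : ℕ} (hP : SatisfiesM123 P r)
    {f : Finset (Site d) → Config d A → RCB} (hf : IsAdmissible f) {ε : ℝ} (hε : 0 < ε) :
    ∃ a : ℝ → ℝ, ∀ᵐ ω ∂P, ∀ᶠ n : ℕ in atTop, ∀ E : ℝ,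
      |(((cube d n).card : ℝ)⁻¹ • f (cube d n) ω).1 E - a E| ≤ ε := by
  obtain ⟨b, hb⟩ := hf.almost_additive
  obtain ⟨C, hC0, hC⟩ := exists_norm_add_le_mul_card hf hb
  -- Small cubes have density `(q + r)^(-d)` per site. The first term is their boundary cost, the
  -- second the cost of the corridors, whose volume fraction `1 - (q / (q + r))^d` tends to zero.
  obtain ⟨q, hq, hqε⟩ : ∃ q : ℕ, 1 ≤ q ∧ (1 / ((q + r : ℕ) : ℝ)) ^ d * b (cube d q) +
      C * (1 - (1 / ((q + r : ℕ) : ℝ)) ^ d * (q : ℝ) ^ d) < ε / 2 := by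
    have h1 : Tendsto (fun q : ℕ => b (cube d q) / (q : ℝ) ^ d) atTop (𝓝 0) := by
      have h := hb.cubes id (fun _ => 0) strictMono_id
      have e : ∀ i : ℕ, translateSet (cube d i) 0 = cube d i := fun i => by simp [translateSet]
      simpa [e, card_cube] using h
    have h2 : Tendsto (fun q : ℕ => ((q : ℝ) / ((q + r : ℕ) : ℝ)) ^ d) atTop (𝓝 1) := by
      have h := (tendsto_natCast_div_add_atTop (r : ℝ)).pow d
      simpa using h
    have h3 := (h1.mul h2).add ((h2.const_sub 1).const_mul C)
    simp only [zero_mul, sub_self, mul_zero, add_zero] at h3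
    obtain ⟨q, hq1, hq2⟩ := ((eventually_ge_atTop 1).and
      (h3.eventually (gt_mem_nhds (half_pos hε)))).exists
    refine ⟨q, hq1, lt_of_le_of_lt (le_of_eq ?_) hq2⟩
    have hq0 : (q : ℝ) ≠ 0 := by positivity
    rw [div_pow, div_pow, one_pow]
    field_simp
  set m := q + r with hm
  have hm0 : 0 < m := by omega
  set K := C * (q : ℝ) ^ d with hKdef
  have hK : ∀ ω, ‖f (cube d q) ω‖ ≤ K := fun ω => by
    have h := hC (cube d q) ω
    have := hb.nonneg (cube d q)
    rw [card_cube] at h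
    push_cast at h
    linarith
  obtain ⟨a, haK, ha⟩ := exists_ae_eventually_abs_average_sub_le hd hP hf hq hK
    (by positivity : 0 < ε / 4)
  refine ⟨fun E => (1 / (m : ℝ)) ^ d * a E, ?_⟩
  filter_upwards [ha] with ω hω
  have hx := (tendsto_natDiv_div m).pow d
  -- The four errors: boundary terms, uncovered volume, the law of large numbers, and replacing `(k
  -- / n)^d` by its limit `(1 / m)^d`. In the limit they total less than `ε / 2 + ε / 4`.
  have herr : Tendsto (fun n : ℕ => (((n / m : ℕ) : ℝ) / n) ^ d * b (cube d q) +
      C * (1 - (((n / m : ℕ) : ℝ) / n) ^ d * (q : ℝ) ^ d) +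
      (((n / m : ℕ) : ℝ) / n) ^ d * (ε / 4) +
      |(((n / m : ℕ) : ℝ) / n) ^ d - (1 / (m : ℝ)) ^ d| * K) atTop
      (𝓝 ((1 / (m : ℝ)) ^ d * b (cube d q) + C * (1 - (1 / (m : ℝ)) ^ d * (q : ℝ) ^ d) +
        (1 / (m : ℝ)) ^ d * (ε / 4) + |(1 / (m : ℝ)) ^ d - (1 / (m : ℝ)) ^ d| * K)) :=
    (((hx.mul_const _).add (((hx.mul_const _).const_sub 1).const_mul C)).add
      (hx.mul_const _)).add ((hx.sub_const _).abs.mul_const K)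
  have hlt : (1 / (m : ℝ)) ^ d * b (cube d q) + C * (1 - (1 / (m : ℝ)) ^ d * (q : ℝ) ^ d) +
        (1 / (m : ℝ)) ^ d * (ε / 4) + |(1 / (m : ℝ)) ^ d - (1 / (m : ℝ)) ^ d| * K < ε := by
    have hm1 : (1 / (m : ℝ)) ^ d ≤ 1 := by
      refine pow_le_one₀ (by positivity) ?_
      rw [div_le_one (by positivity)]
      exact_mod_cast hm0
    have := mul_le_mul_of_nonneg_right hm1 (by positivity : 0 ≤ ε / 4)
    rw [sub_self, abs_zero, zero_mul]
    linarith
  have hk : Tendsto (fun n : ℕ => n / m) atTop atTop := Nat.tendsto_div_const_atTop hm0.ne'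
  filter_upwards [herr.eventually (gt_mem_nhds hlt), hk.eventually hω,
    eventually_ge_atTop 1, hk.eventually (eventually_ge_atTop 1)] with n hn1 hn2 hn3 hn4 E
  refine le_trans ?_ hn1.le
  set k := n / m with hkdef
  have hn0 : (0 : ℝ) < (n : ℝ) ^ d := by positivity
  have hk0 : (0 : ℝ) < (k : ℝ) ^ d := by positivity
  set G : RCB := ∑ t ∈ cube d k, f (cube d q) (shift ((m : ℤ) • t) ω) with hS
  have hdec := norm_cube_sub_sum_le hf hb hC ω (n := n) (k := k) (q := q) (r := r)
    (Nat.div_mul_le_self n m)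
  have hdecE := (abs_apply_le_norm _ E).trans hdec
  have hsumE : G.1 E = ∑ t ∈ cube d k, (f (cube d q) (shift ((m : ℤ) • t) ω)).1 E := by
    have : ∀ S : Finset (Site d), (∑ t ∈ S, f (cube d q) (shift ((m : ℤ) • t) ω)).1 E =
        ∑ t ∈ S, (f (cube d q) (shift ((m : ℤ) • t) ω)).1 E := by
      intro S
      induction S using Finset.induction_on with
      | empty => simp
      | insert t S ht ih => rw [Finset.sum_insert ht, Finset.sum_insert ht, ← ih]; rfl
    exact this _
  have hE := hn2 E
  rw [← hsumE] at hE
  have hdecE' : |(f (cube d n) ω).1 E - G.1 E| ≤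
      (k : ℝ) ^ d * b (cube d q) + C * ((n : ℝ) ^ d - (k : ℝ) ^ d * (q : ℝ) ^ d) := hdecE
  have hval : (((cube d n).card : ℝ)⁻¹ • f (cube d n) ω).1 E =
      ((n : ℝ) ^ d)⁻¹ * (f (cube d n) ω).1 E := by
    rw [card_cube]; push_cast; rfl
  rw [hval]
  have hsplit : ((n : ℝ) ^ d)⁻¹ * (f (cube d n) ω).1 E - (1 / (m : ℝ)) ^ d * a E =
      ((n : ℝ) ^ d)⁻¹ * ((f (cube d n) ω).1 E - G.1 E) +
      ((k : ℝ) / n) ^ d * (((k : ℝ) ^ d)⁻¹ * G.1 E - a E) +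
      (((k : ℝ) / n) ^ d - (1 / (m : ℝ)) ^ d) * a E := by
    rw [div_pow (k : ℝ)]
    field_simp
    ring
  rw [hsplit]
  refine (abs_add_three _ _ _).trans ?_
  refine add_le_add (add_le_add ?_ ?_) ?_
  · rw [abs_mul, abs_of_pos (inv_pos.2 hn0)]
    refine (mul_le_mul_of_nonneg_left hdecE' (inv_pos.2 hn0).le).trans (le_of_eq ?_)
    rw [div_pow]
    field_simp
  · rw [abs_mul, abs_of_nonneg (by positivity)]
    exact mul_le_mul_of_nonneg_left hE (by positivity)
  · rw [abs_mul]
    exact mul_le_mul_of_nonneg_left (haK E) (abs_nonneg _)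

theorem mainTheorem1 (d : ℕ) (hd : 1 ≤ d) (A : Set ℝ) (P : Measure (Config d A))
    [IsProbabilityMeasure P] (r : ℕ) (hP : SatisfiesM123 P r)
    (f : Finset (Site d) → Config d A → RCB) (hf : IsAdmissible f) :
    ∃ Ω' : Set (Config d A), MeasurableSet Ω' ∧ P Ω' = 1 ∧
      ∃ fstar : RCB, ∀ ω ∈ Ω',
        Tendsto (fun n : ℕ => ‖((cube d n).card : ℝ)⁻¹ • f (cube d n) ω - fstar‖)
          atTop (𝓝 0) := by
  set F : Config d A → ℕ → RCB := fun ω n => ((cube d n).card : ℝ)⁻¹ • f (cube d n) ω with hF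
  choose a ha using fun i : ℕ => exists_ae_eventually_abs_cube_sub_le hd hP hf
    (Nat.one_div_pos_of_nat (α := ℝ) (n := i))
  -- The good event need not be measurable, hence a measurable subset of full measure.
  obtain ⟨Ω', hΩae, hΩm, hΩ⟩ := (ae_all_iff.2 ha).exists_measurable_mem
  have hsub : ∀ (G H : RCB) (E : ℝ), (G - H).1 E = G.1 E - H.1 E := fun _ _ _ => rfl
  have hP1 : P Ω' = 1 := (mem_ae_iff_prob_eq_one hΩm).1 hΩae
  obtain ⟨ω₀, hω₀⟩ : Ω'.Nonempty := by
    rw [Set.nonempty_iff_ne_empty]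
    rintro rfl
    simp at hP1
  -- One good configuration suffices to construct the limit.
  have hcauchy : CauchySeq (F ω₀) := by
    refine Metric.cauchySeq_iff'.2 fun ε hε => ?_
    obtain ⟨i, hi⟩ := exists_nat_one_div_lt (half_pos (half_pos hε))
    obtain ⟨N, hN⟩ := eventually_atTop.1 (hΩ ω₀ hω₀ i)
    refine ⟨N, fun n hn => ?_⟩
    rw [dist_eq_norm]
    refine lt_of_le_of_lt (norm_le_of_forall_abs_le (half_pos hε).le fun E => ?_)
      (half_lt_self hε)
    have h1 := abs_le.1 (hN n hn E)
    have h2 := abs_le.1 (hN N le_rfl E)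
    rw [hsub, abs_le]
    constructor <;> linarith [h1.1, h1.2, h2.1, h2.2]
  obtain ⟨fstar, hlim⟩ := cauchySeq_tendsto_of_complete hcauchy
  -- The limit is tied to the deterministic `a i`, so every other configuration in `Ω'` has the same
  -- limit.
  have hclose : ∀ (i : ℕ) (E : ℝ), |fstar.1 E - a i E| ≤ 1 / ((i : ℝ) + 1) := by
    intro i E
    have hE : Tendsto (fun n => (F ω₀ n).1 E) atTop (𝓝 (fstar.1 E)) := by
      rw [tendsto_iff_norm_sub_tendsto_zero] at hlim ⊢
      exact squeeze_zero (fun _ => norm_nonneg _)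
        (fun n => abs_apply_le_norm (F ω₀ n - fstar) E) hlim
    refine le_of_tendsto (hE.sub_const (a i E)).abs ?_
    filter_upwards [hΩ ω₀ hω₀ i] with n hn
    exact hn E
  refine ⟨Ω', hΩm, hP1, fstar, fun ω hω => ?_⟩
  rw [Metric.tendsto_atTop]
  intro ε hε
  obtain ⟨i, hi⟩ := exists_nat_one_div_lt (half_pos (half_pos hε))
  obtain ⟨N, hN⟩ := eventually_atTop.1 (hΩ ω hω i)
  refine ⟨N, fun n hn => ?_⟩
  rw [Real.dist_eq, sub_zero, abs_norm]
  refine lt_of_le_of_lt (norm_le_of_forall_abs_le (half_pos hε).le fun E => ?_) (half_lt_self hε)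
  have h1 := abs_le.1 (hN n hn E)
  have h2 := abs_le.1 (hclose i E)
  rw [hsub, abs_le]
  constructor <;> linarith [h1.1, h1.2, h2.1, h2.2]
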